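/- All matroids are finite. Let $P=p_1\dots p_n$ and $Q=q_1\dots q_n$ be lattice paths from $(0,0)$ to $(m,r)$, where $n=m+r$, with unit north and east steps and with $P$ never going above $Q$. If $p_{u_1},\dots,p_{u_r}$ (with $u_1<\dots<u_r$) are the north steps of $P$ and $q_{l_1},\dots,q_{l_r}$ (with $l_1<\dots<l_r$) are the north steps of $Q$, let $M[P,Q]$ be the transversal matroid on $\{1,\dots,n\}$ with presentation $([l_1,u_1],\dots,[l_r,u_r])$; that is, a set $I\subseteq\{1,\dots,n\}$ is independent if and only if there is an injection $\phi:I\to\{1,\dots,r\}$ with $l_{\phi(x)}\le x\le u_{\phi(x)}$ for all $x\in I$. A lattice path matroid is a matroid that is isomorphic to $M[P,Q]$ for some such $P$ and $Q$ (and some $m,r\ge 0$). A cyclic flat of a matroid $M$ is a flat that is a (possibly empty) union of circuits; the set $\mathcal{Z}(M)$ of cyclic flats, ordered by inclusion, is a lattice. The configuration of $M$ is the $4$-tuple $(L,s,\rho,|E(M)|)$, where $L$ is a lattice for which there is an isomorphism $\phi:L\to\mathcal{Z}(M)$ with $s(x)=|\phi(x)|$ and $\rho(x)=r_M(\phi(x))$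 for all $x\in L$. Two matroids have the same configuration if some $4$-tuple $(L,s,\rho,n)$ is the configuration of both. Theorem. If two lattice path matroids have the same configuration, then they are isomorphic. -/

import Mathlib

namespace LatticePathMatroid

/-! ### Cyclic flats, configurations, isomorphism -/

/-- `M` and `N` are isomorphic: some bijection between their ground sets preserves independence
in both directions. -/
def Isomorphic {α : Type*} {β : Type*} (M : Matroid α) (N : Matroid β) : Prop :=
  ∃ e : M.E ≃ N.E, ∀ I : Set M.E,
    M.Indep (Subtype.val '' I) ↔ N.Indep (Subtype.val '' (e '' I))

/-- A cyclic set is a (possibly empty) union of circuits. -/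
def IsCyclicSet {α : Type*} (M : Matroid α) (X : Set α) : Prop :=
  ∃ S : Set (Set α), (∀ C ∈ S, M.IsCircuit C) ∧ X = ⋃₀ S

/-- The set of cyclic flats of `M`; it is ordered by inclusion. -/
def cyclicFlats {α : Type*} (M : Matroid α) : Set (Set α) :=
  {F | M.IsFlat F ∧ IsCyclicSet M F}

/-- `(L, s, ρ, n)` is the configuration of `M`: the ground set of `M` has `n` elements, and there
is an isomorphism of the lattice `L` onto the lattice of cyclic flats of `M` such that `s` and `ρ`
give the size and the rank of the corresponding cyclic flat.
(Sizes and ranks are compared in `ℕ∞`, so they are in particular finite.) -/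
def IsConfigurationOf {α : Type*} (M : Matroid α)
    (L : Type*) [Lattice L] (s ρ : L → ℕ) (n : ℕ) : Prop :=
  M.E.encard = (n : ℕ∞) ∧
  ∃ φ : L ≃o cyclicFlats M, ∀ x : L,
    (φ x : Set α).encard = (s x : ℕ∞) ∧ M.eRk (φ x : Set α) = (ρ x : ℕ∞)

/-- Some 4-tuple `(L, s, ρ, n)` is the configuration of both `M` and `N`. -/
def SameConfiguration.{u, v, w} {α : Type u} {β : Type v} (M : Matroid α) (N : Matroid β) : Prop :=
  ∃ (L : Type w) (_ : Lattice L) (s ρ : L → ℕ) (n : ℕ),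
    IsConfigurationOf M L s ρ n ∧ IsConfigurationOf N L s ρ n

/-! ### Transversal matroids -/

/-- `I` is a partial transversal of the set system `A`. -/
def IsPartialTransversal {α ι : Type*} (A : ι → Set α) (I : Set α) : Prop :=
  ∃ φ : I → ι, Function.Injective φ ∧ ∀ x : I, (x : α) ∈ A (φ x)

theorem isPartialTransversal_iff {α ι : Type*} [Nonempty ι] (A : ι → Set α) (I : Set α) :
    IsPartialTransversal A I ↔ ∃ f : α → ι, Set.InjOn f I ∧ ∀ x ∈ I, x ∈ A (f x) := by
  classical
  constructor
  · rintro ⟨φ, hφ, hA⟩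
    refine ⟨fun x => if h : x ∈ I then φ ⟨x, h⟩ else Classical.arbitrary ι, ?_, ?_⟩
    · intro x hx y hy hxy
      simp only [hx, hy, dif_pos] at hxy
      exact congrArg Subtype.val (hφ hxy)
    · intro x hx
      simpa only [hx, dif_pos] using hA ⟨x, hx⟩
  · rintro ⟨f, hf, hA⟩
    exact ⟨fun x => f x, fun x y hxy => Subtype.ext (hf x.2 y.2 hxy), fun x => hA x x.2⟩

theorem IsPartialTransversal.augment_aux {α ι : Type*} [Finite α] {A : ι → Set α} {I J : Set α}
    (g : α → ι) (hg : Set.InjOn g J) (hgA : ∀ x ∈ J, x ∈ A (g x)) (hIJ : I.ncard < J.ncard)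
    (k : ℕ) : ∀ f : α → ι, Set.InjOn f I → (∀ x ∈ I, x ∈ A (f x)) →
      {x | x ∈ I ∧ f x ≠ g x}.ncard = k →
      ∃ y ∈ J, y ∉ I ∧ ∃ f' : α → ι, Set.InjOn f' (insert y I) ∧
        ∀ x ∈ insert y I, x ∈ A (f' x) := by
  classical
  induction k using Nat.strong_induction_on with
  | _ k ih =>
    intro f hf hfA hk
    obtain ⟨y, hyJ, hy⟩ : ∃ y ∈ J, g y ∉ f '' I := by
      by_contra! h
      have h1 : (g '' J).ncard ≤ (f '' I).ncard :=
        Set.ncard_le_ncard (by rintro _ ⟨y, hy, rfl⟩; exact h y hy) (Set.toFinite _)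
      rw [hg.ncard_image, hf.ncard_image] at h1
      omega
    have hne : ∀ x ∈ I, f x ≠ g y := fun x hx h => hy ⟨x, hx, h⟩
    have hinj : Set.InjOn (Function.update f y (g y)) (insert y I) := by
      intro a ha b hb hab
      by_cases hay : a = y <;> by_cases hby : b = y
      · rw [hay, hby]
      · subst hay
        rw [Function.update_self, Function.update_of_ne hby] at hab
        exact absurd hab.symm (hne b (hb.resolve_left hby))
      · subst hby
        rw [Function.update_self, Function.update_of_ne hay] at hab
        exact absurd hab (hne a (ha.resolve_left hay))
      · rw [Function.update_of_ne hay, Function.update_of_ne hby] at hab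
        exact hf (ha.resolve_left hay) (hb.resolve_left hby) hab
    have hmem : ∀ x ∈ insert y I, x ∈ A (Function.update f y (g y) x) := by
      intro x hx
      by_cases hxy : x = y
      · subst hxy
        rw [Function.update_self]
        exact hgA x hyJ
      · rw [Function.update_of_ne hxy]
        exact hfA x (hx.resolve_left hxy)
    by_cases hyI : y ∈ I
    · refine ih _ ?_ (Function.update f y (g y)) (hinj.mono (Set.subset_insert _ _))
        (fun x hx => hmem x (Set.mem_insert_of_mem _ hx)) rfl
      rw [← hk]
      refine Set.ncard_lt_ncard ⟨?_, ?_⟩ (Set.toFinite _)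
      · rintro x ⟨hxI, hx⟩
        refine ⟨hxI, ?_⟩
        by_cases hxy : x = y
        · rw [hxy]; exact hne y hyI
        · rwa [Function.update_of_ne hxy] at hx
      · intro h
        have := (h ⟨hyI, hne y hyI⟩ : y ∈ {x | x ∈ I ∧ Function.update f y (g y) x ≠ g x}).2
        exact this (Function.update_self _ _ _)
    · exact ⟨y, hyJ, hyI, _, hinj, hmem⟩

theorem IsPartialTransversal.augment {α ι : Type*} [Finite α] {A : ι → Set α} ⦃I J : Set α⦄
    (hI : IsPartialTransversal A I) (hJ : IsPartialTransversal A J) (hIJ : I.ncard < J.ncard) :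
    ∃ e ∈ J, e ∉ I ∧ IsPartialTransversal A (insert e I) := by
  obtain ⟨x, hx⟩ : J.Nonempty := Set.nonempty_of_ncard_ne_zero (by omega)
  have : Nonempty ι := ⟨hJ.choose ⟨x, hx⟩⟩
  obtain ⟨f, hf, hfA⟩ := (isPartialTransversal_iff A I).1 hI
  obtain ⟨g, hg, hgA⟩ := (isPartialTransversal_iff A J).1 hJ
  obtain ⟨y, hyJ, hyI, h⟩ := augment_aux g hg hgA hIJ _ f hf hfA rfl
  exact ⟨y, hyJ, hyI, (isPartialTransversal_iff A _).2 h⟩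

/-- The transversal matroid with presentation `A`, on the ground set of all elements of the finite
type `α`: its independent sets are the partial transversals of `A`. -/
def transversalMatroid {α ι : Type*} [Finite α] (A : ι → Set α) : Matroid α :=
  (IndepMatroid.ofFinite (E := Set.univ) Set.finite_univ (IsPartialTransversal A)
    ⟨fun x => x.2.elim, fun x => x.2.elim, fun x => x.2.elim⟩
    (fun _ _ hJ hIJ => by
      obtain ⟨φ, hφ, hA⟩ := hJ
      exact ⟨fun x => φ ⟨x, hIJ x.2⟩,
        fun x y hxy => Subtype.ext (Subtype.mk.inj (hφ hxy)),
        fun x => hA ⟨x, hIJ x.2⟩⟩)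
    (fun _ _ hI hJ hIJ => hI.augment hJ hIJ)
    (fun _ _ => Set.subset_univ _)).matroid

theorem transversalMatroid_ground {α ι : Type*} [Finite α] (A : ι → Set α) :
    (transversalMatroid A).E = Set.univ := rfl

theorem transversalMatroid_indep_iff {α ι : Type*} [Finite α] (A : ι → Set α) (I : Set α) :
    (transversalMatroid A).Indep I ↔ IsPartialTransversal A I :=
  Iff.rfl

/-! ### Lattice path matroids -/

/-- The two kinds of unit steps. -/
inductive Step : Type
  | north
  | east
  deriving DecidableEq

/-- A lattice path from `(0, 0)` to `(m, r)`: a word of `m + r` steps, exactly `r` of which are north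
(so the other `m` are east). The steps are indexed by `0, …, m + r - 1`. -/
structure LatticePath (m r : ℕ) where
  step : Fin (m + r) → Step
  card_north : (Finset.univ.filter fun i => step i = Step.north).card = r

/-- The positions of the north steps. -/
def LatticePath.northSteps {m r : ℕ} (P : LatticePath m r) : Finset (Fin (m + r)) :=
  Finset.univ.filter fun i => P.step i = Step.north

/-- The position of the `i`-th north step, the positions being listed in increasing order. -/
def LatticePath.northStep {m r : ℕ} (P : LatticePath m r) (i : Fin r) : Fin (m + r) :=
  P.northSteps.orderEmbOfFin P.card_north i

/-- The height (second coordinate) of the point reached after the first `k` steps. -/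
def LatticePath.height {m r : ℕ} (P : LatticePath m r) (k : ℕ) : ℕ :=
  (P.northSteps.filter fun i : Fin (m + r) => (i : ℕ) < k).card

/-- `P` never goes above `Q`. After `k` steps both paths are on the line `x + y = k`, so this can be
read off from the heights. -/
def LatticePath.NeverAbove {m r : ℕ} (P Q : LatticePath m r) : Prop :=
  ∀ k ≤ m + r, P.height k ≤ Q.height k

/-- The set system `(N_1, …, N_r)`, where `N_i` is the interval from the position of the `i`-th
north step of `Q` to the position of the `i`-th north step of `P`. -/
def pathPresentation {m r : ℕ} (P Q : LatticePath m r) (i : Fin r) : Set (Fin (m + r)) :=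
  Set.Icc (Q.northStep i) (P.northStep i)

/-- The matroid `M[P, Q]`, of interest when `P` never goes above `Q`. -/
def pathMatroid {m r : ℕ} (P Q : LatticePath m r) : Matroid (Fin (m + r)) :=
  transversalMatroid (pathPresentation P Q)

/-- A lattice path matroid is a matroid that is isomorphic to `M[P, Q]` for some lattice paths `P`
and `Q` with the same end points, with `P` never going above `Q`. -/
def IsLatticePathMatroid {α : Type*} (M : Matroid α) : Prop :=
  ∃ (m r : ℕ) (P Q : LatticePath m r), P.NeverAbove Q ∧ Isomorphic M (pathMatroid P Q)

end LatticePathMatroid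

namespace LatticePathMatroid

open Set
open scoped Matroid

/-! ### Cyclic sets and cyclic flats -/

section CyclicFlats

variable {α β : Type*} {M : Matroid α} {X F T : Set α}

/-! Describe a path by the number `cnt B k` of its north steps before `k`. Transported to the
naturals (`IsLP`), a lattice path matroid has as bases exactly the sets `B` with `cnt P ≤ cnt B ≤
cnt Q`, and independence becomes a family of inequalities, one for each interval (`IsLP.indep_iff`).

Direct sums are visible in the configuration. If sizes and ranks are both modular on a pair of
cyclic flats, then meet and join are the actual intersection and union
(`IsConfig.inter_eq_and_union_eq_of_modular`). So once loops and coloops are removed, a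
complementary modular pair in the lattice splits both matroids in the same way. Induction on size
(`hasIso_of_isConfig_of_bot_of_top`) leaves the case where no such pair exists; there the bounding
paths meet only at their ends (`IsConnectedLP.isStrict`).

In that case consider the proper nonempty cyclic flats for which neither the restriction nor the
contraction splits. Each is an initial or a final segment (`IsConnectedLP.eq_Iio_or_eq_Ico`): an
indecomposable flat is an interval, and an interval touching neither end is the intersection of two
segments that split its contraction. Conversely, the corners of `Q` and of `P` give such initial and
final segments (`IsConnectedLP.isFundamental_of_hasSwaps`), and a path that crosses a bound already
does so at a corner. Hence the bases are cut out by the rank bounds on these fundamental flats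
(`IsConnectedLP.isBase_iff`).

The lattice gives the size and rank of each fundamental flat, so all that is missing is whether it
is initial or final. Two of them are comparable exactly when they are of the same kind
(`IsConnectedLP.le_or_le_iff`), so only one global choice remains: the two matroids agree or are
reversals of each other (`IsConnectedLP.hasIso`). -/

theorem IsCyclicSet.subset_ground (h : IsCyclicSet M X) : X ⊆ M.E := by
  obtain ⟨S, hS, rfl⟩ := h
  exact sUnion_subset fun C hC => (hS C hC).subset_ground

theorem isCyclicSet_iff_exists_isCircuit :
    IsCyclicSet M X ↔ ∀ e ∈ X, ∃ C, M.IsCircuit C ∧ e ∈ C ∧ C ⊆ X := by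
  constructor
  · rintro ⟨S, hS, rfl⟩ e ⟨C, hC, heC⟩
    exact ⟨C, hS C hC, heC, subset_sUnion_of_mem hC⟩
  · intro h
    refine ⟨{C | M.IsCircuit C ∧ C ⊆ X}, fun C hC => hC.1, subset_antisymm ?_ ?_⟩
    · intro e he
      obtain ⟨C, hC, heC, hCX⟩ := h e he
      exact ⟨C, ⟨hC, hCX⟩, heC⟩
    · exact sUnion_subset fun C hC => hC.2

/-- A circuit through `e` inside `X` is what witnesses that `X \ {e}` spans `e`. In this form cyclic
flats are handled by closure computations alone. -/
theorem isCyclicSet_iff_mem_closure :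
    IsCyclicSet M X ↔ ∀ e ∈ X, e ∈ M.closure (X \ {e}) := by
  rw [isCyclicSet_iff_exists_isCircuit]
  refine forall₂_congr fun e he => ?_
  rw [Matroid.mem_closure_iff_exists_isCircuit (by simp), insert_sdiff_singleton,
    insert_eq_of_mem he]
  exact ⟨fun ⟨C, h1, h2, h3⟩ => ⟨C, h3, h1, h2⟩, fun ⟨C, h1, h2, h3⟩ => ⟨C, h2, h3, h1⟩⟩

theorem IsCyclicSet.union {Y : Set α} (hX : IsCyclicSet M X) (hY : IsCyclicSet M Y) :
    IsCyclicSet M (X ∪ Y) := by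
  rw [isCyclicSet_iff_mem_closure] at *
  rintro e (he | he)
  · exact M.closure_subset_closure (sdiff_subset_sdiff_left subset_union_left) (hX e he)
  · exact M.closure_subset_closure (sdiff_subset_sdiff_left subset_union_right) (hY e he)

theorem IsCyclicSet.closure_mem_cyclicFlats (hX : IsCyclicSet M X) :
    M.closure X ∈ cyclicFlats M := by
  refine ⟨Matroid.isFlat_closure X, ?_⟩
  have hXcl := M.subset_closure X hX.subset_ground
  rw [isCyclicSet_iff_exists_isCircuit] at *
  intro e he
  by_cases heX : e ∈ X
  · obtain ⟨C, h1, h2, h3⟩ := hX e heX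
    exact ⟨C, h1, h2, h3.trans hXcl⟩
  · obtain ⟨C, h1, h2, h3⟩ := Matroid.exists_isCircuit_of_mem_closure he heX
    exact ⟨C, h2, h3, h1.trans (insert_subset he hXcl)⟩

theorem loops_mem_cyclicFlats (M : Matroid α) : M.loops ∈ cyclicFlats M :=
  IsCyclicSet.closure_mem_cyclicFlats (isCyclicSet_iff_mem_closure.2 (by simp))

theorem mem_cyclicFlats_iff :
    F ∈ cyclicFlats M ↔ M.closure F = F ∧ ∀ e ∈ F, e ∈ M.closure (F \ {e}) := by
  rw [← isCyclicSet_iff_mem_closure, ← Matroid.isFlat_iff_closure_eq]; rfl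

theorem mem_cyclicFlats_map_iff {f : α → β} (hf : InjOn f M.E) {G : Set β} :
    G ∈ cyclicFlats (M.map f hf) ↔ ∃ F ∈ cyclicFlats M, f '' F = G := by
  have key : ∀ F ⊆ M.E, (f '' F ∈ cyclicFlats (M.map f hf) ↔ F ∈ cyclicFlats M) := by
    intro F hF
    have hcl : ∀ X ⊆ M.E, M.closure (f ⁻¹' (f '' X)) = M.closure X := by
      intro X hX
      rw [← M.closure_inter_ground]
      congr 1
      exact hf.preimage_image_inter hX
    rw [mem_cyclicFlats_iff, mem_cyclicFlats_iff, Matroid.map_closure_eq, hcl F hF,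
      hf.image_eq_image_iff (M.closure_subset_ground F) hF, forall_mem_image]
    refine and_congr_right fun _ => forall₂_congr fun e he => ?_
    have : f '' F \ {f e} = f '' (F \ {e}) := by
      rw [(hf.mono hF).image_sdiff_subset (by simpa using he), image_singleton]
    rw [this, Matroid.map_closure_eq, hcl _ (sdiff_subset.trans hF),
      hf.mem_image_iff (M.closure_subset_ground _) (hF he)]
  constructor
  · intro hG
    have hGE : G ⊆ f '' M.E := hG.1.subset_ground
    obtain ⟨F, hF, rfl⟩ := (subset_image_iff).1 hGE
    exact ⟨F, (key F hF).1 hG, rfl⟩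
  · rintro ⟨F, hF, rfl⟩
    exact (key F hF.1.subset_ground).2 hF

theorem mem_cyclicFlats_restrict_iff (hT : M.IsFlat T) :
    F ∈ cyclicFlats (M ↾ T) ↔ F ∈ cyclicFlats M ∧ F ⊆ T := by
  have hTE := hT.subset_ground
  have key : ∀ X ⊆ T, (M ↾ T).closure X = M.closure X := by
    intro X hX
    rw [Matroid.restrict_closure_eq M hX hTE, inter_eq_left]
    exact (M.closure_subset_closure hX).trans hT.closure.subset
  constructor
  · intro h
    have hFT : F ⊆ T := h.1.subset_ground
    refine ⟨?_, hFT⟩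
    rw [mem_cyclicFlats_iff] at *
    rw [key F hFT] at h
    exact ⟨h.1, fun e he => by rw [← key _ (sdiff_subset.trans hFT)]; exact h.2 e he⟩
  · rintro ⟨h, hFT⟩
    rw [mem_cyclicFlats_iff] at *
    rw [key F hFT]
    exact ⟨h.1, fun e he => by rw [key _ (sdiff_subset.trans hFT)]; exact h.2 e he⟩

/-- Loops lie in every closure and do not affect it, so they can be stripped from a cyclic flat and
recovered by closing in `M`. -/
theorem mem_cyclicFlats_restrict_sdiff_loops_iff :
    F ∈ cyclicFlats (M ↾ (M.E \ M.loops)) ↔ ∃ G ∈ cyclicFlats M, G \ M.loops = F := by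
  have key : ∀ X ⊆ M.E \ M.loops,
      (M ↾ (M.E \ M.loops)).closure X = M.closure X \ M.loops := by
    intro X hX
    rw [Matroid.restrict_closure_eq M hX sdiff_subset, ← inter_sdiff_assoc,
      inter_eq_left.2 (M.closure_subset_ground X)]
  constructor
  · intro h
    have hF : F ⊆ M.E \ M.loops := h.1.subset_ground
    rw [mem_cyclicFlats_iff, key F hF] at h
    refine ⟨M.closure F, IsCyclicSet.closure_mem_cyclicFlats
      (isCyclicSet_iff_mem_closure.2 fun e he => ?_), h.1⟩
    have := h.2 e he
    rw [key _ (sdiff_subset.trans hF)] at this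
    exact this.1
  · rintro ⟨G, hG, rfl⟩
    have hGE : G \ M.loops ⊆ M.E \ M.loops := sdiff_subset_sdiff_left hG.1.subset_ground
    rw [mem_cyclicFlats_iff] at hG ⊢
    rw [key _ hGE, M.closure_sdiff_loops_eq, hG.1]
    refine ⟨rfl, fun e he => ?_⟩
    rw [key _ (sdiff_subset.trans hGE), sdiff_sdiff_comm, M.closure_sdiff_loops_eq]
    exact ⟨hG.2 e he.1, he.2⟩

end CyclicFlats

/-! ### Configurations given by a map to sets -/

section Config

variable {α β L : Type*} [Lattice L] {M : Matroid α} {s ρ : L → ℕ} {φ : L → Set α}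

/-- `φ` is an order embedding of `L` into sets whose image consists of the cyclic flats of `M`, and
`s` and `ρ` record the sizes and ranks of these flats. -/
structure IsConfig (M : Matroid α) (s ρ : L → ℕ) (φ : L → Set α) : Prop where
  subset_iff : ∀ x y, φ x ⊆ φ y ↔ x ≤ y
  mem_iff : ∀ F, F ∈ cyclicFlats M ↔ ∃ x, φ x = F
  encard_eq : ∀ x, (φ x).encard = s x
  eRk_eq : ∀ x, M.eRk (φ x) = ρ x

theorem IsConfigurationOf.exists_isConfig {n : ℕ} (h : IsConfigurationOf M L s ρ n) :
    ∃ φ : L → Set α, IsConfig M s ρ φ := by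
  obtain ⟨-, φ, hφ⟩ := h
  refine ⟨fun x => φ x, ⟨fun x y => φ.le_iff_le, fun F => ⟨fun hF => ⟨φ.symm ⟨F, hF⟩, by simp⟩, ?_⟩,
    fun x => (hφ x).1, fun x => (hφ x).2⟩⟩
  rintro ⟨x, rfl⟩
  exact (φ x).2

namespace IsConfig

theorem mem (h : IsConfig M s ρ φ) (x : L) : φ x ∈ cyclicFlats M := (h.mem_iff _).2 ⟨x, rfl⟩

theorem isFlat (h : IsConfig M s ρ φ) (x : L) : M.IsFlat (φ x) := (h.mem x).1

theorem subset_ground (h : IsConfig M s ρ φ) (x : L) : φ x ⊆ M.E := (h.mem x).1.subset_ground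

theorem finite (h : IsConfig M s ρ φ) (x : L) : (φ x).Finite :=
  finite_of_encard_eq_coe (h.encard_eq x)

theorem ncard_eq (h : IsConfig M s ρ φ) (x : L) : (φ x).ncard = s x := by
  rw [ncard, h.encard_eq]; rfl

theorem injective (h : IsConfig M s ρ φ) : Function.Injective φ := fun x y hxy =>
  le_antisymm ((h.subset_iff x y).1 hxy.le) ((h.subset_iff y x).1 hxy.ge)

theorem ncard_inter_le (h : IsConfig M s ρ φ) {I : Set α} (hI : M.Indep I) (x : L) :
    (I ∩ φ x).ncard ≤ ρ x := by
  have := (hI.subset inter_subset_left).encard_le_eRk_of_subset (inter_subset_right (t := φ x))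
  rw [h.eRk_eq, ← ((h.finite x).subset inter_subset_right).cast_ncard_eq] at this
  exact_mod_cast this

theorem map (h : IsConfig M s ρ φ) {f : α → β} (hf : InjOn f M.E) :
    IsConfig (M.map f hf) s ρ fun x => f '' φ x where
  subset_iff x y := by
    rw [hf.image_subset_image_iff (h.subset_ground x) (h.subset_ground y), h.subset_iff]
  mem_iff F := by
    rw [mem_cyclicFlats_map_iff]
    constructor
    · rintro ⟨F, hF, rfl⟩
      obtain ⟨x, rfl⟩ := (h.mem_iff F).1 hF
      exact ⟨x, rfl⟩
    · rintro ⟨x, rfl⟩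
      exact ⟨φ x, h.mem x, rfl⟩
  encard_eq x := by rw [(hf.mono (h.subset_ground x)).encard_image, h.encard_eq]
  eRk_eq x := by rw [Matroid.eRk_map M hf (h.subset_ground x), h.eRk_eq]

theorem restrict (h : IsConfig M s ρ φ) (y : L) :
    IsConfig (L := Iic y) (M ↾ φ y) (fun x => s x) (fun x => ρ x) (fun x => φ x) where
  subset_iff x z := h.subset_iff x z
  mem_iff F := by
    rw [mem_cyclicFlats_restrict_iff (h.isFlat y)]
    constructor
    · rintro ⟨hF, hFy⟩
      obtain ⟨x, rfl⟩ := (h.mem_iff F).1 hF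
      exact ⟨⟨x, (h.subset_iff x y).1 hFy⟩, rfl⟩
    · rintro ⟨x, rfl⟩
      exact ⟨h.mem x, (h.subset_iff x y).2 x.2⟩
  encard_eq x := h.encard_eq x
  eRk_eq x := by rw [M.restrict_eRk_eq ((h.subset_iff x y).2 x.2), h.eRk_eq]

theorem restrict_sdiff_loops (h : IsConfig M s ρ φ) {b : L} (hb : φ b = M.loops) :
    IsConfig (M ↾ (M.E \ M.loops)) (fun x => s x - s b) ρ (fun x => φ x \ M.loops) where
  subset_iff x y := by
    have hx : M.loops ⊆ φ x := by
      rw [← (h.isFlat x).closure]; exact M.closure_subset_closure (empty_subset _)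
    have hy : M.loops ⊆ φ y := by
      rw [← (h.isFlat y).closure]; exact M.closure_subset_closure (empty_subset _)
    rw [← h.subset_iff, sdiff_subset_iff, union_sdiff_cancel hy]
  mem_iff F := by
    rw [mem_cyclicFlats_restrict_sdiff_loops_iff]
    constructor
    · rintro ⟨F, hF, rfl⟩
      obtain ⟨x, rfl⟩ := (h.mem_iff F).1 hF
      exact ⟨x, rfl⟩
    · rintro ⟨x, rfl⟩
      exact ⟨φ x, h.mem x, rfl⟩
  encard_eq x := by
    have hx : M.loops ⊆ φ x := by
      rw [← (h.isFlat x).closure]; exact M.closure_subset_closure (empty_subset _)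
    have hfin := h.finite x
    rw [← (hfin.subset sdiff_subset).cast_ncard_eq, ncard_sdiff hx (hfin.subset hx), h.ncard_eq,
      ← hb, h.ncard_eq]
  eRk_eq x := by
    rw [M.restrict_eRk_eq (sdiff_subset_sdiff_left (h.subset_ground x)),
      ← M.eRk_closure_eq, M.closure_sdiff_loops_eq, M.eRk_closure_eq, h.eRk_eq]

/-- The join lies in the closure of the union, so both have the same rank. Submodularity then bounds
the rank of the intersection by that of the meet, a flat contained in it, so the two coincide.
Counting elements settles the union. -/
theorem inter_eq_and_union_eq_of_modular (h : IsConfig M s ρ φ) {y z : L}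
    (hs : s y + s z = s (y ⊔ z) + s (y ⊓ z)) (hρ : ρ y + ρ z = ρ (y ⊔ z) + ρ (y ⊓ z)) :
    φ y ∩ φ z = φ (y ⊓ z) ∧ φ y ∪ φ z = φ (y ⊔ z) := by
  have hinf : φ (y ⊓ z) ⊆ φ y ∩ φ z :=
    subset_inter ((h.subset_iff _ _).2 inf_le_left) ((h.subset_iff _ _).2 inf_le_right)
  have hsup : φ y ∪ φ z ⊆ φ (y ⊔ z) :=
    union_subset ((h.subset_iff _ _).2 le_sup_left) ((h.subset_iff _ _).2 le_sup_right)
  have hcl : φ (y ⊔ z) ⊆ M.closure (φ y ∪ φ z) := by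
    have hsub := M.subset_closure (φ y ∪ φ z) (union_subset (h.subset_ground y) (h.subset_ground z))
    obtain ⟨w, hw⟩ := (h.mem_iff _).1 ((h.mem y).2.union (h.mem z).2).closure_mem_cyclicFlats
    rw [← hw] at hsub ⊢
    exact (h.subset_iff _ _).2 (sup_le ((h.subset_iff _ _).1 (subset_union_left.trans hsub))
      ((h.subset_iff _ _).1 (subset_union_right.trans hsub)))
  have hrk : M.eRk (φ y ∪ φ z) = ρ (y ⊔ z) := by
    refine le_antisymm ((M.eRk_mono hsup).trans_eq (h.eRk_eq _)) ?_
    rw [← h.eRk_eq, ← M.eRk_closure_eq (φ y ∪ φ z)]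
    exact M.eRk_mono hcl
  have hsub := M.eRk_inter_add_eRk_union_le (φ y) (φ z)
  rw [hrk, h.eRk_eq, h.eRk_eq] at hsub
  have hle : M.eRk (φ y ∩ φ z) ≤ M.eRk (φ (y ⊓ z)) := by
    rw [h.eRk_eq]
    have h1 : M.eRk (φ y ∩ φ z) ≠ ⊤ := by
      intro h1; rw [h1] at hsub; simp at hsub
    lift M.eRk (φ y ∩ φ z) to ℕ using h1 with k
    norm_cast at hsub ⊢
    omega
  have hI : φ y ∩ φ z = φ (y ⊓ z) := by
    refine subset_antisymm ?_ hinf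
    have := (M.isRkFinite_of_finite (h.finite (y ⊓ z))).closure_eq_closure_of_subset_of_eRk_ge_eRk
      hinf hle
    rw [(h.isFlat _).closure] at this
    rw [this]
    exact M.subset_closure _ (inter_subset_left.trans (h.subset_ground y))
  refine ⟨hI, ((h.finite _).subset hsup).eq_of_subset_of_encard_le hsup ?_⟩
  have := ncard_union_add_ncard_inter (φ y) (φ z) (h.finite y) (h.finite z)
  rw [hI, h.ncard_eq, h.ncard_eq, h.ncard_eq] at this
  rw [h.encard_eq, ← ((h.finite _).subset hsup).cast_ncard_eq]
  norm_cast
  omega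

end IsConfig

end Config

/-! ### Separators -/

section Separators

variable {α β : Type*} {M : Matroid α} {N : Matroid β} {y z : Set α}

/-- `y` is a separator of `M`: independence can be tested on `y` and on its complement. -/
def IsSep (M : Matroid α) (y : Set α) : Prop :=
  y ⊆ M.E ∧ ∀ I ⊆ M.E, M.Indep (I ∩ y) → M.Indep (I \ y) → M.Indep I

theorem IsSep.indep_iff (h : IsSep M y) {I : Set α} (hI : I ⊆ M.E) :
    M.Indep I ↔ M.Indep (I ∩ y) ∧ M.Indep (I \ y) :=
  ⟨fun h => ⟨h.subset inter_subset_left, h.subset sdiff_subset⟩, fun h' => h.2 I hI h'.1 h'.2⟩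

theorem IsSep.compl (h : IsSep M y) : IsSep M (M.E \ y) := by
  refine ⟨sdiff_subset, fun I hI h1 h2 => h.2 I hI ?_ ?_⟩
  · rwa [sdiff_sdiff_right, sdiff_eq_empty.2 hI, empty_union] at h2
  · rwa [← inter_sdiff_assoc, inter_eq_left.2 hI] at h1

/-- Extend the two parts of `I` to bases of `y` and `z`. Their union spans `M` and has at most
rank-many elements, so it is a base containing `I`. -/
theorem isSep_of_eRk_add_eRk_le (hfin : M.E.Finite) (hyz : y ∪ z = M.E)
    (h : M.eRk y + M.eRk z ≤ M.eRank) : IsSep M y := by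
  have hy : y ⊆ M.E := hyz ▸ subset_union_left
  have hz : z ⊆ M.E := hyz ▸ subset_union_right
  refine ⟨hy, fun I hI h1 h2 => ?_⟩
  obtain ⟨A, hA, hIA⟩ := h1.subset_isBasis_of_subset inter_subset_right
  have h3 : I \ y ⊆ z := by rw [sdiff_subset_iff, hyz]; exact hI
  obtain ⟨B, hB, hIB⟩ := h2.subset_isBasis_of_subset h3
  have hAB : M.IsBase (A ∪ B) := by
    rw [← M.isBasis_ground_iff]
    refine (M.isRkFinite_of_finite hfin).isBasis_of_subset_closure_of_subset_of_encard_le ?_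
      (union_subset (hA.subset.trans hy) (hB.subset.trans hz)) ?_
    · rw [← hyz]
      exact union_subset (hA.subset_closure.trans (M.closure_subset_closure subset_union_left))
        (hB.subset_closure.trans (M.closure_subset_closure subset_union_right))
    · rw [M.eRk_ground]
      refine (encard_union_le A B).trans ?_
      rwa [hA.encard_eq_eRk, hB.encard_eq_eRk]
  refine hAB.indep.subset ?_
  rw [← inter_union_sdiff I y]
  exact union_subset_union hIA hIB

theorem IsSep.isCircuit_subset (h : IsSep M y) {C : Set α} (hC : M.IsCircuit C) :
    C ⊆ y ∨ Disjoint C y := by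
  by_contra! hcon
  refine hC.not_indep (h.2 C hC.subset_ground (hC.ssubset_indep ?_) (hC.ssubset_indep ?_))
  · exact inter_ssubset_left_iff.2 hcon.1
  · refine ⟨sdiff_subset, fun h' => hcon.2 ?_⟩
    rw [disjoint_left]
    exact fun a ha => (h' ha).2

/-- Every circuit lies on one side of a separator. An outside element spanned by `y` would therefore
be a loop, and the circuits covering `y` stay inside it. -/
theorem IsSep.mem_cyclicFlats (h : IsSep M y) (hloops : M.loops = ∅) (hE : IsCyclicSet M M.E) :
    y ∈ cyclicFlats M := by
  refine ⟨Matroid.isFlat_iff_closure_eq.2 (subset_antisymm (fun e he => ?_)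
    (M.subset_closure y h.1)), ?_⟩
  · by_contra hey
    obtain ⟨C, hC, hCC, heC⟩ := Matroid.exists_isCircuit_of_mem_closure he hey
    obtain h' | h' := h.isCircuit_subset hCC
    · exact hey (h' heC)
    · have : C = {e} := by
        refine subset_antisymm (fun a ha => ?_) (by simpa using heC)
        exact (hC ha).resolve_right (disjoint_left.1 h' ha)
      rw [this, Matroid.singleton_isCircuit, Matroid.isLoop_iff, hloops] at hCC
      exact hCC
  · rw [isCyclicSet_iff_exists_isCircuit] at hE ⊢
    intro e he
    obtain ⟨C, hC, heC, -⟩ := hE e (h.1 he)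
    refine ⟨C, hC, heC, (h.isCircuit_subset hC).resolve_right fun h' => ?_⟩
    exact disjoint_left.1 h' heC he

/-- `M` and `N` are isomorphic by a function between the ambient types. -/
def HasIso (M : Matroid α) (N : Matroid β) : Prop :=
  ∃ f : α → β, BijOn f M.E N.E ∧ ∀ I ⊆ M.E, M.Indep I ↔ N.Indep (f '' I)

theorem HasIso.glue {y : Set α} {y' : Set β} (hy : IsSep M y) (hy' : IsSep N y')
    (h₁ : HasIso (M ↾ y) (N ↾ y')) (h₂ : HasIso (M ↾ (M.E \ y)) (N ↾ (N.E \ y'))) :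
    HasIso M N := by
  classical
  obtain ⟨f, hf, hfI⟩ := h₁
  obtain ⟨g, hg, hgI⟩ := h₂
  simp only [Matroid.restrict_ground_eq, Matroid.restrict_indep_iff] at hf hfI hg hgI
  set k : α → β := y.piecewise f g with hk
  have hkf : EqOn k f y := piecewise_eqOn y f g
  have hkg : EqOn k g (M.E \ y) := fun a ha => piecewise_eq_of_notMem y f g ha.2
  have hkf' : BijOn k y y' := hf.congr hkf.symm
  have hkg' : BijOn k (M.E \ y) (N.E \ y') := hg.congr hkg.symm
  have hbij : BijOn k M.E N.E := by
    have := hkf'.union hkg' ?_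
    · rwa [union_sdiff_cancel hy.1, union_sdiff_cancel hy'.1] at this
    · rw [injOn_union disjoint_sdiff_right]
      refine ⟨hkf'.injOn, hkg'.injOn, fun a ha b hb hab => (hkg'.mapsTo hb).2 ?_⟩
      rw [← hab]; exact hkf'.mapsTo ha
  refine ⟨k, hbij, fun I hI => ?_⟩
  have e1 : k '' I ∩ y' = f '' (I ∩ y) := by
    rw [← (hkf.mono inter_subset_right).image_eq, hbij.injOn.image_inter hI hy.1, hkf'.image_eq]
  have e2 : k '' I \ y' = g '' (I \ y) := by
    rw [← (hkg.mono (sdiff_subset_sdiff_left hI)).image_eq, ← hkf'.image_eq]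
    ext b
    constructor
    · rintro ⟨⟨a, ha, rfl⟩, hb⟩
      exact ⟨a, ⟨ha, fun h => hb ⟨a, h, rfl⟩⟩, rfl⟩
    · rintro ⟨a, ⟨ha, hay⟩, rfl⟩
      refine ⟨⟨a, ha, rfl⟩, ?_⟩
      rintro ⟨c, hc, hca⟩
      exact hay (hbij.injOn (hy.1 hc) (hI ha) hca ▸ hc)
  have hkI : k '' I ⊆ N.E := (image_mono hI).trans hbij.image_eq.subset
  rw [hy.indep_iff hI, hy'.indep_iff hkI, e1, e2]
  have h1 := hfI (I ∩ y) inter_subset_right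
  have h2 := hgI (I \ y) (sdiff_subset_sdiff_left hI)
  have h3 : f '' (I ∩ y) ⊆ y' := e1 ▸ inter_subset_right
  have h4 : g '' (I \ y) ⊆ N.E \ y' := e2 ▸ sdiff_subset_sdiff_left hkI
  rw [and_iff_left inter_subset_right, and_iff_left h3] at h1
  rw [and_iff_left (sdiff_subset_sdiff_left hI), and_iff_left h4] at h2
  rw [h1, h2]

end Separators

/-! ### Counting elements below a bound -/

section Count

/-- The number of elements of `B` that are less than `k`. -/
noncomputable def cnt (B : Set ℕ) (k : ℕ) : ℕ := (B ∩ Iio k).ncard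

variable {A B X : Set ℕ} {k : ℕ}

theorem finite_inter_Iio (B : Set ℕ) (k : ℕ) : (B ∩ Iio k).Finite :=
  (finite_Iio k).subset inter_subset_right

@[simp] theorem cnt_zero (B : Set ℕ) : cnt B 0 = 0 := by simp [cnt]

theorem cnt_succ_of_mem (h : k ∈ B) : cnt B (k + 1) = cnt B k + 1 := by
  rw [cnt, cnt, ← ncard_insert_of_notMem (a := k) (by simp) (finite_inter_Iio B k)]
  congr 1
  ext a
  simp only [mem_inter_iff, mem_Iio, mem_insert_iff]
  constructor
  · rintro ⟨h1, h2⟩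
    rcases eq_or_ne a k with h3 | h3
    · exact Or.inl h3
    · exact Or.inr ⟨h1, by omega⟩
  · rintro (rfl | ⟨h1, h2⟩)
    · exact ⟨h, by omega⟩
    · exact ⟨h1, by omega⟩

theorem cnt_succ_of_notMem (h : k ∉ B) : cnt B (k + 1) = cnt B k := by
  rw [cnt, cnt]
  congr 1
  ext a
  simp only [mem_inter_iff, mem_Iio]
  refine and_congr_right fun ha => ?_
  have : a ≠ k := fun h' => h (h' ▸ ha)
  omega

theorem cnt_mono (B : Set ℕ) : Monotone (cnt B) := fun _ k hjk =>
  ncard_le_ncard (inter_subset_inter_right B (Iio_subset_Iio hjk)) (finite_inter_Iio B k)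

theorem cnt_add_le (B : Set ℕ) (k d : ℕ) : cnt B (k + d) ≤ cnt B k + d := by
  induction d with
  | zero => rfl
  | succ d ih =>
    by_cases h : k + d ∈ B
    · have := cnt_succ_of_mem h
      rw [← add_assoc]; omega
    · have := cnt_succ_of_notMem h
      rw [← add_assoc]; omega

theorem cnt_union (h : Disjoint A B) (k : ℕ) : cnt (A ∪ B) k = cnt A k + cnt B k := by
  rw [cnt, union_inter_distrib_right]
  exact ncard_union_eq (h.mono inter_subset_left inter_subset_left) (finite_inter_Iio _ _)
    (finite_inter_Iio _ _)

theorem cnt_inter_add_cnt_sdiff (A B : Set ℕ) (k : ℕ) :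
    cnt (A ∩ B) k + cnt (A \ B) k = cnt A k := by
  rw [← cnt_union (disjoint_sdiff_inter.symm), inter_union_sdiff]

theorem cnt_eq_ncard (h : B ⊆ Iio k) : cnt B k = B.ncard := by
  rw [cnt, inter_eq_left.2 h]

end Count

/-! ### Lattice path matroids on sets of natural numbers -/

section IsLP

/-- `M` is a matroid on a finite set of natural numbers, and its bases are the sets of north steps of
the paths between the paths with the sets of north steps `P` and `Q`. -/
structure IsLP (M : Matroid ℕ) (P Q : Set ℕ) : Prop where
  finite : M.E.Finite
  left_subset : P ⊆ M.E
  right_subset : Q ⊆ M.E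
  isBase_iff : ∀ B ⊆ M.E, M.IsBase B ↔ ∀ k, cnt P k ≤ cnt B k ∧ cnt B k ≤ cnt Q k

namespace IsLP

variable {M : Matroid ℕ} {P Q : Set ℕ}

theorem cnt_le_cnt (h : IsLP M P Q) (k : ℕ) : cnt P k ≤ cnt Q k := by
  obtain ⟨B, hB⟩ := M.exists_isBase
  have := (h.isBase_iff B hB.subset_ground).1 hB k
  exact this.1.trans this.2

theorem isBase_left (h : IsLP M P Q) : M.IsBase P :=
  (h.isBase_iff P h.left_subset).2 fun k => ⟨le_rfl, h.cnt_le_cnt k⟩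

theorem isBase_right (h : IsLP M P Q) : M.IsBase Q :=
  (h.isBase_iff Q h.right_subset).2 fun k => ⟨h.cnt_le_cnt k, le_rfl⟩

end IsLP

theorem IsSep.isBasis_inter {α : Type*} {M : Matroid α} {y B : Set α} (h : IsSep M y)
    (hB : M.IsBase B) : M.IsBasis (B ∩ y) y := by
  refine (hB.indep.subset inter_subset_left).isBasis_of_forall_insert inter_subset_right ?_
  intro e he
  have heE := h.1 he.1
  refine ⟨fun hI => ?_, insert_subset heE (inter_subset_left.trans hB.subset_ground)⟩
  have heB : e ∉ B := fun h' => he.2 ⟨h', he.1⟩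
  refine (hB.insert_dep ⟨heE, heB⟩).not_indep (h.2 _ (insert_subset heE hB.subset_ground) ?_ ?_)
  · rwa [insert_inter_of_mem he.1]
  · rw [insert_sdiff_of_mem _ he.1]
    exact hB.indep.subset sdiff_subset

theorem IsSep.isBase_union {α : Type*} {M : Matroid α} {y A B : Set α} (h : IsSep M y)
    (hA : M.IsBasis A y) (hB : M.IsBase B) : M.IsBase (A ∪ B \ y) := by
  have hAE := hA.indep.subset_ground
  have hBE := hB.subset_ground
  have e1 : (A ∪ B \ y) ∩ y = A := by
    rw [union_inter_distrib_right, inter_eq_left.2 hA.subset, sdiff_inter_self, union_empty]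
  have e2 : (A ∪ B \ y) \ y = B \ y := by
    rw [union_sdiff_distrib, sdiff_eq_empty.2 hA.subset, empty_union, sdiff_idem]
  have hsub : A ∪ B \ y ⊆ M.E := union_subset hAE (sdiff_subset.trans hBE)
  refine Matroid.Indep.isBase_of_forall_insert (h.2 _ hsub ?_ ?_) fun e he hI => ?_
  · rw [e1]; exact hA.indep
  · rw [e2]; exact hB.indep.subset sdiff_subset
  · rw [h.indep_iff (insert_subset he.1 hsub)] at hI
    by_cases hey : e ∈ y
    · rw [insert_inter_of_mem hey, e1] at hI
      exact (hA.insert_dep ⟨hey, fun h' => he.2 (Or.inl h')⟩).not_indep hI.1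
    · rw [insert_sdiff_of_notMem _ hey, e2] at hI
      have heB : e ∉ B := fun h' => he.2 (Or.inr ⟨h', hey⟩)
      refine (hB.insert_dep ⟨he.1, heB⟩).not_indep (h.2 _ (insert_subset he.1 hBE) ?_ ?_)
      · rw [insert_inter_of_notMem hey]; exact hB.indep.subset inter_subset_left
      · rw [insert_sdiff_of_notMem _ hey]; exact hI.2

/-- Bases of the two sides combine freely. Completing `A` by the outside part of `P` or of `Q` and
comparing with that same path, the outside counts cancel and leave the bounds on `y`. -/
theorem IsLP.restrict {M : Matroid ℕ} {P Q y : Set ℕ} (h : IsLP M P Q) (hy : IsSep M y) :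
    IsLP (M ↾ y) (P ∩ y) (Q ∩ y) where
  finite := h.finite.subset hy.1
  left_subset := inter_subset_right
  right_subset := inter_subset_right
  isBase_iff A hA := by
    rw [Matroid.restrict_ground_eq] at hA
    rw [Matroid.isBase_restrict_iff hy.1]
    have hd : ∀ B : Set ℕ, Disjoint A (B \ y) := fun B => disjoint_sdiff_right.mono_left hA
    have hbase : ∀ A B, M.IsBasis A y → M.IsBase B → ∀ k,
        cnt P k ≤ cnt (A ∪ B \ y) k ∧ cnt (A ∪ B \ y) k ≤ cnt Q k := fun A B hA hB => by
      have := hy.isBase_union hA hB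
      exact (h.isBase_iff _ this.subset_ground).1 this
    constructor
    · intro hA k
      have h1 := (hbase A P hA h.isBase_left k).1
      have h2 := (hbase A Q hA h.isBase_right k).2
      rw [cnt_union (hd _)] at h1 h2
      have := cnt_inter_add_cnt_sdiff P y k
      have := cnt_inter_add_cnt_sdiff Q y k
      omega
    · intro hk
      have hb : M.IsBase (A ∪ P \ y) := by
        rw [h.isBase_iff _ (union_subset (hA.trans hy.1) (sdiff_subset.trans h.left_subset))]
        intro k
        -- The hybrid base, `Q` inside `y` and `P` outside, stays below `Q`; this gives the upper
        -- bound for `A ∪ P \ y`.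
        have h1 := (hbase _ P (hy.isBasis_inter h.isBase_right) h.isBase_left k).2
        rw [cnt_union (disjoint_sdiff_right.mono_left inter_subset_right)] at h1
        rw [cnt_union (hd _)]
        have := cnt_inter_add_cnt_sdiff P y k
        have := hk k
        omega
      have := hy.isBasis_inter hb
      rwa [union_inter_distrib_right, inter_eq_left.2 hA, sdiff_inter_self, union_empty] at this

/-- Restriction to a separator can leave a ground set with holes. Sending each element to its
position in the ground set closes them without changing the path inequalities. -/
theorem IsLP.exists_map {M : Matroid ℕ} {P Q : Set ℕ} (h : IsLP M P Q) :
    ∃ (f : ℕ → ℕ) (hf : InjOn f M.E) (P' Q' : Set ℕ), IsLP (M.map f hf) P' Q' ∧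
      (M.map f hf).E = Iio M.E.ncard := by
  set n := M.E.ncard with hn
  have hlt : ∀ e ∈ M.E, ∀ k, cnt M.E e < cnt M.E k ↔ e < k := by
    intro e he k
    constructor
    · intro h1
      by_contra! h2
      exact absurd (cnt_mono M.E h2) (by omega)
    · intro h1
      have := cnt_mono M.E (show e + 1 ≤ k from h1)
      have := cnt_succ_of_mem he
      omega
  have hf : InjOn (cnt M.E) M.E := by
    intro a ha b hb hab
    have := hlt a ha b
    have := hlt b hb a
    omega
  obtain ⟨N, hN⟩ := h.finite.bddAbove
  have hEN : M.E ⊆ Iio (N + 1) := fun e he => Nat.lt_succ_of_le (hN he)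
  have hcN : cnt M.E (N + 1) = n := cnt_eq_ncard hEN
  have himg : cnt M.E '' M.E = Iio n := by
    refine eq_of_subset_of_ncard_le ?_ ?_ (finite_Iio n)
    · rintro _ ⟨e, he, rfl⟩
      rw [← hcN]
      exact (hlt e he _).2 (hEN he)
    · rw [hf.ncard_image]; simp [hn]
  have hcnt : ∀ B ⊆ M.E, ∀ k, cnt (cnt M.E '' B) (cnt M.E k) = cnt B k := by
    intro B hB k
    change (cnt M.E '' B ∩ Iio (cnt M.E k)).ncard = (B ∩ Iio k).ncard
    rw [← (hf.mono (inter_subset_left.trans hB)).ncard_image (s := B ∩ Iio k)]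
    congr 1
    ext a
    constructor
    · rintro ⟨⟨e, he, rfl⟩, hlt'⟩
      exact ⟨e, ⟨he, (hlt e (hB he) k).1 hlt'⟩, rfl⟩
    · rintro ⟨e, ⟨he, hek⟩, rfl⟩
      exact ⟨⟨e, he, rfl⟩, (hlt e (hB he) k).2 hek⟩
  -- A threshold below `n` is the position of some element. From `n` on everything is counted, as at
  -- `N + 1`.
  have hex : ∀ k', ∃ k, ∀ B ⊆ M.E, cnt (cnt M.E '' B) k' = cnt B k := by
    intro k'
    rcases lt_or_ge k' n with hk | hk
    · obtain ⟨e, he, rfl⟩ : k' ∈ cnt M.E '' M.E := himg ▸ hk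
      exact ⟨e, fun B hB => hcnt B hB e⟩
    · refine ⟨N + 1, fun B hB => ?_⟩
      have h1 : cnt M.E '' B ⊆ Iio n := himg ▸ image_mono hB
      rw [← hcnt B hB, hcN, cnt_eq_ncard h1, cnt_eq_ncard (h1.trans (Iio_subset_Iio hk))]
  refine ⟨cnt M.E, hf, cnt M.E '' P, cnt M.E '' Q, ⟨h.finite.image _,
    image_mono h.left_subset, image_mono h.right_subset, ?_⟩, himg⟩
  intro B' hB'
  obtain ⟨B, hB, rfl⟩ := subset_image_iff.1 hB'
  rw [Matroid.map_image_isBase_iff hB, h.isBase_iff B hB]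
  constructor
  · intro H k'
    obtain ⟨k, hk⟩ := hex k'
    rw [hk _ hB, hk _ h.left_subset, hk _ h.right_subset]
    exact H k
  · intro H k
    rw [← hcnt _ hB, ← hcnt _ h.left_subset, ← hcnt _ h.right_subset]
    exact H _

end IsLP

/-! ### The matroid of a pair of lattice paths -/

section PathMatroid

variable {N r : ℕ}

/-- Otherwise, just past the `i`-th element of `S` there are already more elements of `S` than of
`T`. -/
theorem orderEmbOfFin_le_of_card_filter_le {S T : Finset (Fin N)} (hS : S.card = r)
    (hT : T.card = r)
    (h : ∀ k : ℕ, (S.filter fun i : Fin N => (i : ℕ) < k).card ≤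
      (T.filter fun i : Fin N => (i : ℕ) < k).card) (i : Fin r) :
    T.orderEmbOfFin hT i ≤ S.orderEmbOfFin hS i := by
  by_contra! hlt
  have h1 : (Finset.univ.filter fun j : Fin r => j ≤ i).card ≤
      (S.filter fun a : Fin N => (a : ℕ) < S.orderEmbOfFin hS i + 1).card := by
    refine Finset.card_le_card_of_injOn (S.orderEmbOfFin hS) (fun j hj => ?_)
      (S.orderEmbOfFin hS).injective.injOn
    simp only [Finset.coe_filter, Finset.mem_univ, true_and, mem_ofPred_eq] at hj ⊢
    refine ⟨Finset.orderEmbOfFin_mem S hS j, ?_⟩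
    have : S.orderEmbOfFin hS j ≤ S.orderEmbOfFin hS i := (S.orderEmbOfFin hS).monotone hj
    have : (S.orderEmbOfFin hS j : ℕ) ≤ S.orderEmbOfFin hS i := this
    omega
  have h2 : (T.filter fun a : Fin N => (a : ℕ) < S.orderEmbOfFin hS i + 1).card ≤
      (Finset.univ.filter fun j : Fin r => j < i).card := by
    refine Finset.card_le_card_of_surjOn (T.orderEmbOfFin hT) (fun a ha => ?_)
    simp only [Finset.coe_filter, mem_ofPred_eq] at ha
    have hr : a ∈ Set.range (T.orderEmbOfFin hT) := by
      rw [Finset.range_orderEmbOfFin]; exact ha.1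
    obtain ⟨j, rfl⟩ := hr
    refine ⟨j, ?_, rfl⟩
    simp only [Finset.coe_filter, Finset.mem_univ, true_and, mem_ofPred_eq]
    refine (T.orderEmbOfFin hT).lt_iff_lt.1 (lt_of_le_of_lt ?_ hlt)
    exact Nat.lt_succ_iff.1 ha.2
  have h3 : (Finset.univ.filter fun j : Fin r => j < i).card <
      (Finset.univ.filter fun j : Fin r => j ≤ i).card := by
    refine Finset.card_lt_card ⟨fun j hj => ?_, fun hh => ?_⟩
    · simp only [Finset.mem_filter, Finset.mem_univ, true_and] at hj ⊢
      exact hj.le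
    · have := @hh i (by simp)
      simp at this
  have := h (S.orderEmbOfFin hS i + 1)
  omega

variable {m : ℕ} {P Q : LatticePath m r}

theorem LatticePath.card_northSteps (P : LatticePath m r) : P.northSteps.card = r := P.card_north

theorem LatticePath.height_eq_of_le (P : LatticePath m r) {k : ℕ} (hk : m + r ≤ k) :
    P.height k = r := by
  rw [LatticePath.height, Finset.filter_true_of_mem fun i _ => by omega, P.card_northSteps]

theorem LatticePath.NeverAbove.height_le (h : P.NeverAbove Q) (k : ℕ) :
    P.height k ≤ Q.height k := by
  rcases le_total k (m + r) with hk | hk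
  · exact h k hk
  · rw [P.height_eq_of_le hk, Q.height_eq_of_le hk]

theorem isPartialTransversal_of_card_filter {B : Finset (Fin (m + r))} (hB : B.card = r)
    (h : ∀ k : ℕ, P.height k ≤ (B.filter fun i : Fin (m + r) => (i : ℕ) < k).card ∧
      (B.filter fun i : Fin (m + r) => (i : ℕ) < k).card ≤ Q.height k) :
    IsPartialTransversal (pathPresentation P Q) (B : Set (Fin (m + r))) := by
  refine ⟨fun x => (B.orderIsoOfFin hB).symm ⟨x, x.2⟩, fun x y hxy => ?_, fun x => ?_⟩
  · have := (B.orderIsoOfFin hB).symm.injective hxy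
    exact Subtype.ext (congrArg (fun z : B => (z : Fin (m + r))) this)
  · set i := (B.orderIsoOfFin hB).symm ⟨x, x.2⟩ with hi
    have hx : B.orderEmbOfFin hB i = x := by
      rw [← Finset.coe_orderIsoOfFin_apply, hi, OrderIso.apply_symm_apply]
    rw [← hx]
    exact ⟨orderEmbOfFin_le_of_card_filter_le hB Q.card_north (fun k => (h k).2) i,
      orderEmbOfFin_le_of_card_filter_le P.card_north hB (fun k => (h k).1) i⟩

theorem card_le_of_isPartialTransversal {B : Finset (Fin (m + r))}
    (h : IsPartialTransversal (pathPresentation P Q) (B : Set (Fin (m + r)))) : B.card ≤ r := by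
  obtain ⟨φ, hφ, -⟩ := h
  simpa using Fintype.card_le_of_injective φ hφ

/-- With `r` elements the matching is a bijection. An element of `B` before `k` is matched to a
north step of `Q` before `k`, and a north step of `P` before `k` is matched to an element of `B`
before `k`. -/
theorem card_filter_of_isPartialTransversal {B : Finset (Fin (m + r))} (hB : B.card = r)
    (h : IsPartialTransversal (pathPresentation P Q) (B : Set (Fin (m + r)))) (k : ℕ) :
    P.height k ≤ (B.filter fun i : Fin (m + r) => (i : ℕ) < k).card ∧
      (B.filter fun i : Fin (m + r) => (i : ℕ) < k).card ≤ Q.height k := by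
  classical
  obtain ⟨φ, hφ, hA⟩ := h
  have hbij : Function.Bijective φ :=
    (Fintype.bijective_iff_injective_and_card φ).2 ⟨hφ, by simpa using hB⟩
  constructor
  · refine Finset.card_le_card_of_surjOn
      (fun x => if hx : x ∈ B then P.northStep (φ ⟨x, hx⟩) else x) (fun u hu => ?_)
    simp only [Finset.coe_filter, mem_ofPred_eq] at hu
    have hr : u ∈ Set.range (P.northSteps.orderEmbOfFin P.card_northSteps) := by
      rw [Finset.range_orderEmbOfFin]; exact hu.1
    obtain ⟨i, rfl⟩ := hr
    obtain ⟨x, rfl⟩ := hbij.2 i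
    refine ⟨x, ?_, ?_⟩
    · simp only [Finset.coe_filter, mem_ofPred_eq]
      exact ⟨x.2, lt_of_le_of_lt (hA x).2 hu.2⟩
    · have hx : (x : Fin (m + r)) ∈ B := x.2
      simp only [hx, dif_pos]
      rfl
  · refine Finset.card_le_card_of_injOn
      (fun x => if hx : x ∈ B then Q.northStep (φ ⟨x, hx⟩) else x) (fun x hx => ?_) ?_
    · simp only [Finset.coe_filter, mem_ofPred_eq] at hx ⊢
      simp only [hx.1, dif_pos]
      exact ⟨Finset.orderEmbOfFin_mem _ _ _, lt_of_le_of_lt (hA ⟨x, hx.1⟩).1 hx.2⟩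
    · intro x hx y hy hxy
      simp only [Finset.coe_filter, mem_ofPred_eq] at hx hy
      simp only [hx.1, hy.1, dif_pos] at hxy
      exact congrArg Subtype.val (hφ ((Q.northSteps.orderEmbOfFin Q.card_north).injective hxy))

theorem pathMatroid_isBase_iff (h : P.NeverAbove Q) (B : Finset (Fin (m + r))) :
    (pathMatroid P Q).IsBase B ↔
      ∀ k : ℕ, P.height k ≤ (B.filter fun i : Fin (m + r) => (i : ℕ) < k).card ∧
        (B.filter fun i : Fin (m + r) => (i : ℕ) < k).card ≤ Q.height k := by
  classical
  have hindep : ∀ I, (pathMatroid P Q).Indep I ↔ IsPartialTransversal (pathPresentation P Q) I :=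
    transversalMatroid_indep_iff _
  have hbase : ∀ C : Finset (Fin (m + r)), C.card = r → (pathMatroid P Q).Indep C →
      (pathMatroid P Q).IsBase C := by
    intro C hC hI
    obtain ⟨D, hD, hCD⟩ := hI.exists_isBase_superset
    have h1 := card_le_of_isPartialTransversal (B := D.toFinset) (P := P) (Q := Q)
      (by rw [← hindep]; simpa using hD.indep)
    have h2 : C ⊆ D.toFinset := by
      intro x hx; simpa using hCD hx
    have h3 := Finset.eq_of_subset_of_card_le h2 (by omega)
    rw [h3]; simpa using hD
  have hQ : (pathMatroid P Q).IsBase Q.northSteps := by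
    refine hbase _ Q.card_northSteps ?_
    rw [hindep]
    exact isPartialTransversal_of_card_filter Q.card_northSteps fun k => ⟨h.height_le k, le_rfl⟩
  constructor
  · intro hB
    refine card_filter_of_isPartialTransversal ?_ ((hindep _).1 hB.indep)
    have := hB.encard_eq_encard_of_isBase hQ
    rw [encard_coe_eq_coe_finsetCard, encard_coe_eq_coe_finsetCard, Q.card_northSteps] at this
    exact_mod_cast this
  · intro hk
    have hB : B.card = r := by
      have := hk (m + r)
      rw [P.height_eq_of_le le_rfl, Q.height_eq_of_le le_rfl,
        Finset.filter_true_of_mem fun i _ => i.2] at this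
      omega
    exact hbase B hB ((hindep _).2 (isPartialTransversal_of_card_filter hB hk))

theorem isLP_map_pathMatroid (h : P.NeverAbove Q) :
    IsLP ((pathMatroid P Q).map (Fin.val) Fin.val_injective.injOn)
      (Fin.val '' (P.northSteps : Set (Fin (m + r))))
      (Fin.val '' (Q.northSteps : Set (Fin (m + r)))) where
  finite := (toFinite _).image _
  left_subset := image_mono (subset_univ _)
  right_subset := image_mono (subset_univ _)
  isBase_iff B hB := by
    classical
    obtain ⟨B, -, rfl⟩ := subset_image_iff.1 hB
    obtain ⟨B, rfl⟩ := B.toFinite.exists_finset_coe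
    have hcnt : ∀ (S : Finset (Fin (m + r))) (k : ℕ), cnt (Fin.val '' (S : Set (Fin (m + r)))) k =
        (S.filter fun i : Fin (m + r) => (i : ℕ) < k).card := by
      intro S k
      rw [cnt, ← ncard_coe_finset, ← ncard_image_of_injective _ Fin.val_injective]
      congr 1
      ext a
      constructor
      · rintro ⟨⟨i, hi, rfl⟩, hik⟩
        exact ⟨i, by simpa using ⟨hi, hik⟩, rfl⟩
      · rintro ⟨i, hi, rfl⟩
        simp only [Finset.coe_filter, mem_ofPred_eq] at hi
        exact ⟨⟨i, hi.1, rfl⟩, hi.2⟩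
    rw [Matroid.map_image_isBase_iff (subset_univ _), pathMatroid_isBase_iff h]
    simp only [hcnt]
    rfl

end PathMatroid

/-! ### Paths and bases -/

section Paths

theorem mem_iff_cnt_succ {B : Set ℕ} {j : ℕ} : j ∈ B ↔ cnt B (j + 1) = cnt B j + 1 := by
  refine ⟨cnt_succ_of_mem, fun h => ?_⟩
  by_contra h'
  rw [cnt_succ_of_notMem h'] at h
  omega

theorem cnt_succ_le (B : Set ℕ) (j : ℕ) : cnt B (j + 1) ≤ cnt B j + 1 := cnt_add_le B j 1

theorem cnt_add_ncard_inter_Ico (B : Set ℕ) {a b : ℕ} (hab : a ≤ b) :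
    cnt B a + (B ∩ Ico a b).ncard = cnt B b := by
  rw [cnt, cnt, ← ncard_union_eq ?_ (finite_inter_Iio _ _)
    ((finite_Ico a b).subset inter_subset_right), ← inter_union_distrib_left]
  · congr 2
    ext e
    simp only [mem_union, mem_Iio, mem_Ico]
    omega
  · rw [disjoint_left]
    rintro e ⟨-, h1⟩ ⟨-, h2⟩
    simp only [mem_Iio, mem_Ico] at h1 h2
    omega

variable {M : Matroid ℕ} {P Q : Set ℕ} {n : ℕ}

theorem IsLP.ncard_eq (h : IsLP M P Q) : P.ncard = Q.ncard := by
  rw [ncard, ncard, h.isBase_left.encard_eq_encard_of_isBase h.isBase_right]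

theorem IsLP.cnt_eq_cnt (h : IsLP M P Q) (hE : M.E = Iio n) {k : ℕ} (hk : n ≤ k) :
    cnt P k = cnt Q k := by
  have hs : M.E ⊆ Iio k := hE ▸ Iio_subset_Iio hk
  rw [cnt_eq_ncard (h.left_subset.trans hs), cnt_eq_ncard (h.right_subset.trans hs), h.ncard_eq]

theorem IsLP.exists_isBase_of_path (h : IsLP M P Q) (hE : M.E = Iio n) (R : ℕ → ℕ)
    (hR : ∀ k, cnt P k ≤ R k ∧ R k ≤ cnt Q k) (hmono : ∀ k, R k ≤ R (k + 1))
    (hstep : ∀ k, R (k + 1) ≤ R k + 1) : ∃ B, M.IsBase B ∧ ∀ k, cnt B k = R k := by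
  set B : Set ℕ := {j | R (j + 1) = R j + 1} with hB
  have hcnt : ∀ k, cnt B k = R k := by
    intro k
    induction k with
    | zero => have := (hR 0).2; simp at this; simp [this]
    | succ k ih =>
      by_cases hk : k ∈ B
      · rw [cnt_succ_of_mem hk, ih]; exact hk.symm
      · rw [cnt_succ_of_notMem hk, ih]
        have h1 : R (k + 1) ≠ R k + 1 := hk
        have := hmono k
        have := hstep k
        omega
  refine ⟨B, (h.isBase_iff B fun j hj => ?_).2 fun k => by rw [hcnt]; exact hR k, hcnt⟩
  -- From `n` on the two bounds agree and are constant, so `R` cannot rise there.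
  rw [hE, mem_Iio]
  by_contra! hnj
  have h1 := h.cnt_eq_cnt hE hnj
  have h2 := h.cnt_eq_cnt hE (show n ≤ j + 1 by omega)
  have h3 := hR j
  have h4 := hR (j + 1)
  have hPj : j ∉ P := fun hj => by
    have := h.left_subset hj
    rw [hE, mem_Iio] at this
    omega
  have h5 := cnt_succ_of_notMem hPj
  have h6 : R (j + 1) = R j + 1 := hj
  omega

/-- Clamping between the bounding paths keeps all increments in `{0, 1}`, so any height function
with such increments yields a base, even if it leaves the region. -/
theorem IsLP.exists_isBase_clamp (h : IsLP M P Q) (hE : M.E = Iio n) (S : ℕ → ℕ)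
    (hmono : ∀ k, S k ≤ S (k + 1)) (hstep : ∀ k, S (k + 1) ≤ S k + 1) :
    ∃ B, M.IsBase B ∧ ∀ k, cnt B k = max (cnt P k) (min (cnt Q k) (S k)) := by
  refine h.exists_isBase_of_path hE _ (fun k => ?_) (fun k => ?_) (fun k => ?_)
  · have := h.cnt_le_cnt k
    omega
  · have := cnt_mono P (Nat.le_succ k)
    have := cnt_mono Q (Nat.le_succ k)
    have := hmono k
    simp only [Nat.succ_eq_add_one] at *
    omega
  · have := cnt_succ_le P k
    have := cnt_succ_le Q k
    have := hstep k
    omega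

/-- A set is independent if and only if each interval contains at most as many of its elements as
there are between the bounding paths. -/
theorem IsLP.indep_iff (h : IsLP M P Q) (hE : M.E = Iio n) {I : Set ℕ} :
    M.Indep I ↔ ∀ a b, a ≤ b → (I ∩ Ico a b).ncard + cnt P a ≤ cnt Q b := by
  classical
  constructor
  · intro hI a b hab
    obtain ⟨B, hB, hIB⟩ := hI.exists_isBase_superset
    have h1 := (h.isBase_iff B hB.subset_ground).1 hB
    have h2 := cnt_add_ncard_inter_Ico B hab
    have h3 : (I ∩ Ico a b).ncard ≤ (B ∩ Ico a b).ncard :=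
      ncard_le_ncard (inter_subset_inter_left _ hIB) ((finite_Ico a b).subset inter_subset_right)
    have := (h1 a).1
    have := (h1 b).2
    omega
  · intro hc
    -- The lowest path that steps north at every element of `I` and never drops below `P`.
    let R : ℕ → ℕ := fun k =>
      Nat.rec 0 (fun k x => max (x + if k ∈ I then 1 else 0) (cnt P (k + 1))) k
    have hR0 : R 0 = 0 := rfl
    have hRs : ∀ k, R (k + 1) = max (R k + if k ∈ I then 1 else 0) (cnt P (k + 1)) := fun k => rfl
    have hlow : ∀ k, cnt P k ≤ R k := by
      intro k
      cases k with
      | zero => simp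
      | succ k => rw [hRs]; exact le_max_right _ _
    -- Going back to a place `a` where `R` was last reset to `P`, the height at `k` is `cnt P a`
    -- plus the number of elements of `I` in `[a, k)`. The interval inequality then keeps `R` below
    -- `Q`.
    have hform : ∀ k, ∃ a ≤ k, R k + cnt I a = cnt P a + cnt I k := by
      intro k
      induction k with
      | zero => exact ⟨0, le_rfl, by simp [hR0]⟩
      | succ k ih =>
        obtain ⟨a, hak, ha⟩ := ih
        rw [hRs]
        rcases max_choice (R k + if k ∈ I then 1 else 0) (cnt P (k + 1)) with hm | hm
        · refine ⟨a, by omega, ?_⟩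
          rw [hm]
          by_cases hk : k ∈ I
          · rw [cnt_succ_of_mem hk, if_pos hk]; omega
          · rw [cnt_succ_of_notMem hk, if_neg hk]; omega
        · exact ⟨k + 1, le_rfl, by rw [hm]⟩
    have hup : ∀ k, R k ≤ cnt Q k := by
      intro k
      obtain ⟨a, hak, ha⟩ := hform k
      have := hc a k hak
      have := cnt_add_ncard_inter_Ico I hak
      omega
    have hmono : ∀ k, R k ≤ R (k + 1) := by
      intro k
      rw [hRs]; exact le_max_of_le_left (Nat.le_add_right _ _)
    have hstep : ∀ k, R (k + 1) ≤ R k + 1 := by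
      intro k
      rw [hRs]
      have h2 := cnt_succ_le P k
      have h3 := hlow k
      refine max_le ?_ (by omega)
      split_ifs <;> omega
    obtain ⟨B, hB, hcnt⟩ :=
      h.exists_isBase_of_path hE R (fun k => ⟨hlow k, hup k⟩) hmono hstep
    refine hB.indep.subset fun j hj => ?_
    rw [mem_iff_cnt_succ, hcnt, hcnt]
    have h1 := hRs j
    rw [if_pos hj] at h1
    have h2 := cnt_succ_le P j
    have h3 := hlow j
    omega

/-- For an interval containing the meeting point, add the inequalities of its two halves; the terms
`cnt Q k` and `cnt P k` cancel. -/
theorem isSep_Iio (h : IsLP M P Q) (hE : M.E = Iio n) {k : ℕ} (hk : k ≤ n)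
    (hPQ : cnt P k = cnt Q k) : IsSep M (Iio k) := by
  refine ⟨hE ▸ Iio_subset_Iio hk, fun I _ h1 h2 => ?_⟩
  rw [h.indep_iff hE] at h1
  rw [h.indep_iff hE] at h2
  rw [h.indep_iff hE]
  intro a b hab
  have hle : ∀ c d, c ≤ d → d ≤ k → (I ∩ Ico c d).ncard + cnt P c ≤ cnt Q d := by
    intro c d hcd hd
    convert h1 c d hcd using 3
    ext e; simp only [mem_inter_iff, mem_Ico, mem_Iio]
    constructor
    · exact fun H => ⟨⟨H.1, by omega⟩, H.2⟩
    · exact fun H => ⟨H.1.1, H.2⟩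
  have hge : ∀ c d, c ≤ d → k ≤ c → (I ∩ Ico c d).ncard + cnt P c ≤ cnt Q d := by
    intro c d hcd hc
    convert h2 c d hcd using 3
    ext e; simp only [mem_inter_iff, mem_Ico, mem_sdiff, mem_Iio]
    constructor
    · exact fun H => ⟨⟨H.1, by omega⟩, H.2⟩
    · exact fun H => ⟨H.1.1, H.2⟩
  rcases le_total b k with hb | hb
  · exact hle a b hab hb
  rcases le_total k a with ha | ha
  · exact hge a b hab ha
  have e1 := hle a k ha le_rfl
  have e2 := hge k b hb le_rfl
  have e3 := cnt_add_ncard_inter_Ico I ha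
  have e4 := cnt_add_ncard_inter_Ico I hb
  have e5 := cnt_add_ncard_inter_Ico I hab
  omega

end Paths

/-! ### Swaps of consecutive elements -/

section Swaps

/-- For each `p`, other than the one for which `p` and `p + 1` are separated by the cut at `k`,
there are two bases, both with `v` elements below `k`, which differ only in that one has `p` and the
other has `p + 1`. -/
def HasSwaps (M : Matroid ℕ) (n k v : ℕ) : Prop :=
  ∀ p, p + 1 < n → p + 1 ≠ k → ∃ B B', M.IsBase B ∧ M.IsBase B' ∧ cnt B k = v ∧ cnt B' k = v ∧
    p ∉ B ∧ p + 1 ∈ B ∧ p ∈ B' ∧ p + 1 ∉ B' ∧ ∀ j, j ≠ p → j ≠ p + 1 → (j ∈ B ↔ j ∈ B')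

variable {M : Matroid ℕ} {P Q : Set ℕ} {n k v : ℕ}

/-- The two height functions go around opposite sides of one unit square. The bounds on `t` put that
square between `P` and `Q`, so clamping does not disturb it. -/
theorem IsLP.exists_swap_of_paths (h : IsLP M P Q) (hE : M.E = Iio n) {p t : ℕ}
    (hk : p + 1 ≠ k) (hv : cnt P k ≤ v ∧ v ≤ cnt Q k)
    (ht : cnt P (p + 1) ≤ t ∧ t + 1 ≤ cnt Q (p + 1)) (S S' : ℕ → ℕ)
    (hS : ∀ k, S k ≤ S (k + 1) ∧ S (k + 1) ≤ S k + 1)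
    (hS' : ∀ k, S' k ≤ S' (k + 1) ∧ S' (k + 1) ≤ S' k + 1) (hSS' : ∀ j, j ≠ p + 1 → S j = S' j)
    (h0 : S p = t) (h1 : S (p + 1) = t) (h2 : S (p + 2) = t + 1) (h1' : S' (p + 1) = t + 1)
    (hSk : S k = v) : ∃ B B', M.IsBase B ∧ M.IsBase B' ∧ cnt B k = v ∧ cnt B' k = v ∧
    p ∉ B ∧ p + 1 ∈ B ∧ p ∈ B' ∧ p + 1 ∉ B' ∧ ∀ j, j ≠ p → j ≠ p + 1 → (j ∈ B ↔ j ∈ B') := by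
  obtain ⟨B, hB, hBc⟩ := h.exists_isBase_clamp hE S (fun k => (hS k).1) fun k => (hS k).2
  obtain ⟨B', hB', hBc'⟩ := h.exists_isBase_clamp hE S' (fun k => (hS' k).1) fun k => (hS' k).2
  have e0 := hSS' p (by omega)
  have e2 := hSS' (p + 2) (by omega)
  have b0 := cnt_mono P (show p ≤ p + 1 by omega)
  have b1 := cnt_succ_le Q p
  have b2 := cnt_succ_le P (p + 1)
  have b3 := cnt_mono Q (show p + 1 ≤ p + 1 + 1 by omega)
  rw [show p + 1 + 1 = p + 2 from rfl] at b2 b3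
  have clamp : ∀ {a b x : ℕ}, a ≤ x → x ≤ b → max a (min b x) = x := fun ha hb => by
    rw [min_eq_right hb, max_eq_right ha]
  have c0 : cnt B p = t := by rw [hBc, h0]; exact clamp (by omega) (by omega)
  have c1 : cnt B (p + 1) = t := by rw [hBc, h1]; exact clamp (by omega) (by omega)
  have c2 : cnt B (p + 2) = t + 1 := by rw [hBc, h2]; exact clamp (by omega) (by omega)
  have c0' : cnt B' p = t := by rw [hBc', ← e0, h0]; exact clamp (by omega) (by omega)
  have c1' : cnt B' (p + 1) = t + 1 := by rw [hBc', h1']; exact clamp (by omega) (by omega)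
  have c2' : cnt B' (p + 2) = t + 1 := by rw [hBc', ← e2, h2]; exact clamp (by omega) (by omega)
  refine ⟨B, B', hB, hB', ?_, ?_, ?_, ?_, ?_, ?_, fun j hj hj' => ?_⟩
  · rw [hBc, hSk]; exact clamp hv.1 hv.2
  · rw [hBc', ← hSS' k hk.symm, hSk]; exact clamp hv.1 hv.2
  · rw [mem_iff_cnt_succ, c0, c1]; omega
  · rw [mem_iff_cnt_succ, show p + 1 + 1 = p + 2 from rfl, c1, c2]
  · rw [mem_iff_cnt_succ, c0', c1']
  · rw [mem_iff_cnt_succ, show p + 1 + 1 = p + 2 from rfl, c1', c2']; omega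
  · rw [mem_iff_cnt_succ, mem_iff_cnt_succ, hBc, hBc, hBc', hBc', hSS' j hj', hSS' (j + 1) (by omega)]

theorem IsLP.exists_swap_of_lt (h : IsLP M P Q) (hE : M.E = Iio n) {p t : ℕ}
    (hk : p + 1 < k) (hv : cnt P k ≤ v ∧ v ≤ cnt Q k)
    (ht : cnt P (p + 1) ≤ t ∧ t + 1 ≤ cnt Q (p + 1)) (htv : t + 1 ≤ v)
    (hvt : v ≤ t + (k - (p + 1))) : ∃ B B', M.IsBase B ∧ M.IsBase B' ∧ cnt B k = v ∧ cnt B' k = v ∧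
    p ∉ B ∧ p + 1 ∈ B ∧ p ∈ B' ∧ p + 1 ∉ B' ∧ ∀ j, j ≠ p → j ≠ p + 1 → (j ∈ B ↔ j ∈ B') := by
  -- Flat at height `t` up to `p + 1` (truncated subtraction), then climbing until it reaches `v`,
  -- no later than at `k`. The partner is raised by one at `p + 1` only.
  refine h.exists_swap_of_paths hE hk.ne hv ht (fun j => min v (t + (j - (p + 1))))
    (fun j => if j = p + 1 then t + 1 else min v (t + (j - (p + 1)))) (fun j => ?_) (fun j => ?_)
    (fun j hj => ?_) ?_ ?_ ?_ (if_pos rfl) ?_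
  · omega
  · split_ifs <;> omega
  · rw [if_neg hj]
  all_goals omega

theorem IsLP.exists_swap_of_gt (h : IsLP M P Q) (hE : M.E = Iio n) {p t : ℕ}
    (hk : k < p + 1) (hv : cnt P k ≤ v ∧ v ≤ cnt Q k)
    (ht : cnt P (p + 1) ≤ t ∧ t + 1 ≤ cnt Q (p + 1)) (hvt : v ≤ t)
    (htv : t + 1 ≤ v + (p + 1 - k)) : ∃ B B', M.IsBase B ∧ M.IsBase B' ∧ cnt B k = v ∧
    cnt B' k = v ∧ p ∉ B ∧ p + 1 ∈ B ∧ p ∈ B' ∧ p + 1 ∉ B' ∧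
    ∀ j, j ≠ p → j ≠ p + 1 → (j ∈ B ↔ j ∈ B') := by
  -- The mirror image: height `v` at `k`, then a climb that arrives at `t + 1` at `p + 1`. The
  -- partner is lowered by one there only.
  refine h.exists_swap_of_paths hE hk.ne' hv ht
    (fun j => if j = p + 1 then t else max v (t + 1 - (p + 1 - j)))
    (fun j => max v (t + 1 - (p + 1 - j))) (fun j => ?_) (fun j => ?_)
    (fun j hj => ?_) ?_ ?_ ?_ ?_ ?_
  · split_ifs <;> omega
  · omega
  · rw [if_neg hj]
  all_goals (try simp only [if_true])
  all_goals (try split_ifs) <;> omega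

/-- The two bounding paths meet only at their ends. -/
def IsStrict (P Q : Set ℕ) (n : ℕ) : Prop := ∀ k, 0 < k → k < n → cnt P k < cnt Q k

theorem IsLP.hasSwaps_right (h : IsLP M P Q) (hE : M.E = Iio n) (hs : IsStrict P Q n) {q : ℕ}
    (hq : q ∉ Q) (hq' : q + 1 ∈ Q) : HasSwaps M n (q + 1) (cnt Q (q + 1)) := by
  have hqn : q + 1 < n := by have := h.right_subset hq'; rwa [hE] at this
  have hv : cnt P (q + 1) ≤ cnt Q (q + 1) ∧ cnt Q (q + 1) ≤ cnt Q (q + 1) :=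
    ⟨h.cnt_le_cnt _, le_rfl⟩
  intro p hp hpq
  have hlt := hs (p + 1) (by omega) hp
  rcases lt_or_gt_of_ne hpq with hlt' | hlt'
  · have h1 := cnt_succ_of_notMem hq
    have h2 := cnt_add_le Q (p + 1) (q - (p + 1))
    rw [show p + 1 + (q - (p + 1)) = q by omega] at h2
    have h3 := cnt_add_le P (p + 1) (q + 1 - (p + 1))
    have h4 := cnt_mono Q (show p + 1 ≤ q + 1 by omega)
    have h5 := h.cnt_le_cnt (q + 1)
    -- The top unit square before the cut. Strictness puts it above `P`, and the east step `q` of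
    -- `Q` supplies the missing unit for reaching `v` in time.
    refine h.exists_swap_of_lt hE (t := cnt Q (p + 1) - 1) hlt' hv ?_ ?_ ?_
    all_goals omega
  · have h1 := cnt_succ_of_mem hq'
    have h2 := cnt_add_le P (q + 1) (p + 1 - (q + 1))
    rw [show q + 1 + (p + 1 - (q + 1)) = p + 1 by omega] at h2
    have h4 := cnt_mono Q (show q + 2 ≤ p + 1 by omega)
    have h5 := hs (q + 1) (by omega) hqn
    rw [show q + 1 + 1 = q + 2 from rfl] at h1
    -- As low as `P` and the height at the cut allow. The north step `q + 1` of `Q` leaves room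
    -- above, and strictness at `q + 1` makes this height reachable.
    refine h.exists_swap_of_gt hE (t := max (cnt P (p + 1)) (cnt Q (q + 1))) hlt' hv ?_ ?_ ?_
    all_goals omega

theorem IsLP.hasSwaps_left (h : IsLP M P Q) (hE : M.E = Iio n) (hs : IsStrict P Q n) {q : ℕ}
    (hq : q ∈ P) (hq' : q + 1 ∉ P) :
    HasSwaps M n (q + 1) (cnt P (q + 1)) := by
  have hv : cnt P (q + 1) ≤ cnt P (q + 1) ∧ cnt P (q + 1) ≤ cnt Q (q + 1) :=
    ⟨le_rfl, h.cnt_le_cnt _⟩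
  intro p hp hpq
  have hlt := hs (p + 1) (by omega) hp
  rcases lt_or_gt_of_ne hpq with hlt' | hlt'
  · have h1 := cnt_succ_of_mem hq
    have h2 := cnt_mono P (show p + 1 ≤ q by omega)
    have h3 := cnt_add_le P (p + 1) (q + 1 - (p + 1))
    rw [show p + 1 + (q + 1 - (p + 1)) = q + 1 by omega] at h3
    refine h.exists_swap_of_lt hE (t := cnt P (p + 1)) hlt' hv ?_ ?_ ?_
    all_goals omega
  · have h1 := cnt_succ_of_notMem hq'
    have h2 := cnt_add_le P (q + 2) (p + 1 - (q + 2))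
    rw [show q + 2 + (p + 1 - (q + 2)) = p + 1 by omega] at h2
    have h4 := cnt_mono P (show q + 1 ≤ p + 1 by omega)
    rw [show q + 1 + 1 = q + 2 from rfl] at h1
    refine h.exists_swap_of_gt hE (t := cnt P (p + 1)) hlt' hv ?_ ?_ ?_
    all_goals omega

theorem IsLP.two_le_of_right (h : IsLP M P Q) (hE : M.E = Iio n) (hs : IsStrict P Q n) {q : ℕ}
    (hq : q ∉ Q) (hq' : q + 1 ∈ Q) : 0 < q ∧ q + 2 < n := by
  have hqn : q + 1 < n := by have := h.right_subset hq'; rwa [hE] at this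
  have h1 := cnt_succ_of_notMem hq
  have h2 := cnt_succ_of_mem hq'
  have h3 := hs (q + 1) (by omega) hqn
  have h4 := cnt_succ_le P (q + 1)
  refine ⟨?_, ?_⟩
  · rcases Nat.eq_zero_or_pos q with rfl | h'
    · simp at h1; simp [h1] at h3
    · exact h'
  · by_contra h'
    have := h.cnt_eq_cnt hE (show n ≤ q + 1 + 1 by omega)
    omega

theorem IsLP.two_le_of_left (h : IsLP M P Q) (hE : M.E = Iio n) (hs : IsStrict P Q n) {q : ℕ}
    (hqn : q + 1 < n) (hq : q ∈ P) (hq' : q + 1 ∉ P) : 0 < q ∧ q + 2 < n := by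
  have h1 := cnt_succ_of_mem hq
  have h2 := cnt_succ_of_notMem hq'
  have h3 := hs (q + 1) (by omega) hqn
  have h4 := cnt_succ_le Q q
  have h5 := cnt_mono Q (show q + 1 ≤ q + 1 + 1 by omega)
  refine ⟨?_, ?_⟩
  · rcases Nat.eq_zero_or_pos q with rfl | h'
    · simp only [cnt_zero] at h1 h4; omega
    · exact h'
  · by_contra h'
    have := h.cnt_eq_cnt hE (show n ≤ q + 1 + 1 by omega)
    omega

/-- Every element belongs to a swapped pair other than the one across the cut, because both sides of
the cut have at least two elements. -/
theorem HasSwaps.exists_mem_notMem {q : ℕ} (h : HasSwaps M n (q + 1) v) (hq : 0 < q)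
    (hqn : q + 2 < n) {e : ℕ} (he : e < n) :
    (∃ B, M.IsBase B ∧ cnt B (q + 1) = v ∧ e ∈ B) ∧
      ∃ B, M.IsBase B ∧ cnt B (q + 1) = v ∧ e ∉ B := by
  by_cases hcase : e ≠ q ∧ e + 1 < n
  · obtain ⟨B, B', h1, h2, h3, h4, h5, -, h6, -⟩ := h e hcase.2 (by omega)
    exact ⟨⟨B', h2, h4, h6⟩, B, h1, h3, h5⟩
  · obtain ⟨e, rfl⟩ : ∃ e', e = e' + 1 := ⟨e - 1, by omega⟩
    obtain ⟨B, B', h1, h2, h3, h4, -, h5, -, h6, -⟩ := h e he (by omega)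
    exact ⟨⟨B, h1, h3, h5⟩, B', h2, h4, h6⟩

/-- All the bases in question attain both bounds, so a swap cannot change the number of elements in
`y`. A set separating `p` from `p + 1` would see that number change by one. -/
theorem HasSwaps.mem_iff_succ_mem (h : HasSwaps M n k v) (hfin : M.E.Finite) {y z : Set ℕ}
    {c d : ℕ} (hle : ∀ B, M.IsBase B → (B ∩ y).ncard ≤ c ∧ (B ∩ z).ncard ≤ d)
    (hge : ∀ B, M.IsBase B → cnt B k = v → c + d ≤ (B ∩ y).ncard + (B ∩ z).ncard)
    {p : ℕ} (hp : p + 1 < n) (hpk : p + 1 ≠ k) : p ∈ y ↔ p + 1 ∈ y := by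
  obtain ⟨B, B', hB, hB', hc, hc', h1, h2, h3, h4, h5⟩ := h p hp hpk
  have e1 := hle B hB
  have e2 := hle B' hB'
  have e3 := hge B hB hc
  have e4 := hge B' hB' hc'
  have heq : (B ∩ y).ncard = (B' ∩ y).ncard := by omega
  by_contra hcon
  have f1 : (B ∩ y).Finite := (hfin.subset hB.subset_ground).subset inter_subset_left
  have f2 : (B' ∩ y).Finite := (hfin.subset hB'.subset_ground).subset inter_subset_left
  by_cases hpy : p ∈ y
  · have hpy' : p + 1 ∉ y := fun h => hcon ⟨fun _ => h, fun _ => hpy⟩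
    have : B ∩ y ⊂ B' ∩ y := by
      refine ⟨fun j hj => ⟨(h5 j ?_ ?_).1 hj.1, hj.2⟩, fun hh => h1 (hh ⟨h3, hpy⟩).1⟩
      · rintro rfl; exact h1 hj.1
      · rintro rfl; exact hpy' hj.2
    have := ncard_lt_ncard this f2
    omega
  · have hpy' : p + 1 ∈ y := by
      by_contra h; exact hcon ⟨fun h' => absurd h' hpy, fun h' => absurd h' h⟩
    have : B' ∩ y ⊂ B ∩ y := by
      refine ⟨fun j hj => ⟨(h5 j ?_ ?_).2 hj.1, hj.2⟩, fun hh => h4 (hh ⟨h2, hpy'⟩).1⟩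
      · rintro rfl; exact hpy hj.2
      · rintro rfl; exact h4 hj.1
    have := ncard_lt_ncard this f1
    omega

/-- A base meeting `A` in `c` elements contains a basis of `A`. If it avoids `e ∈ A`, then `A \ {e}`
spans `e`; if it contains `e ∉ A`, then `A` does not span `e`. -/
theorem mem_cyclicFlats_of_isBase {α : Type*} {M : Matroid α} (hfin : M.E.Finite) {A : Set α}
    (hA : A ⊆ M.E) (hne : A.Nonempty) {c : ℕ} (hle : ∀ B, M.IsBase B → (B ∩ A).ncard ≤ c)
    (hin : ∀ e ∈ A, ∃ B, M.IsBase B ∧ (B ∩ A).ncard = c ∧ e ∉ B)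
    (hout : ∀ e ∈ M.E \ A, ∃ B, M.IsBase B ∧ (B ∩ A).ncard = c ∧ e ∈ B) :
    A ∈ cyclicFlats M ∧ M.eRk A = c := by
  have hAfin := hfin.subset hA
  have hrk : M.eRk A ≤ c := by
    rw [Matroid.eRk_le_iff]
    intro I hIA hI
    obtain ⟨B, hB, hIB⟩ := hI.exists_isBase_superset
    have h1 := ncard_le_ncard (subset_inter hIB hIA) (hAfin.subset inter_subset_right)
    rw [← (hAfin.subset hIA).cast_ncard_eq]
    exact_mod_cast h1.trans (hle B hB)
  have hbas : ∀ B, M.IsBase B → (B ∩ A).ncard = c → M.IsBasis (B ∩ A) A := by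
    intro B hB hc
    have hf : (B ∩ A).Finite := hAfin.subset inter_subset_right
    refine (hB.indep.subset inter_subset_left).isBasis_of_eRk_ge hf inter_subset_right ?_
    rw [(hB.indep.subset inter_subset_left).eRk_eq_encard, ← hf.cast_ncard_eq, hc]
    exact hrk
  constructor
  · rw [mem_cyclicFlats_iff]
    constructor
    · refine subset_antisymm (fun e he => ?_) (M.subset_closure A hA)
      by_contra heA
      obtain ⟨B, hB, hc, heB⟩ := hout e ⟨M.closure_subset_ground A he, heA⟩
      rw [← (hbas B hB hc).closure_eq_closure] at he
      refine hB.indep.notMem_closure_sdiff_of_mem heB (M.closure_subset_closure ?_ he)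
      exact fun a ha => ⟨ha.1, fun h => heA (h ▸ ha.2)⟩
    · intro e he
      obtain ⟨B, hB, hc, heB⟩ := hin e he
      refine M.closure_subset_closure ?_ ((hbas B hB hc).subset_closure he)
      exact fun a ha => ⟨ha.2, fun h => heB (h ▸ ha.1)⟩
  · obtain ⟨e, he⟩ := hne
    obtain ⟨B, hB, hc, -⟩ := hin e he
    have := (hbas B hB hc).encard_eq_eRk
    rw [← this, ← (hAfin.subset inter_subset_right).cast_ncard_eq, hc]

theorem IsLP.Iio_mem_cyclicFlats (h : IsLP M P Q) (hE : M.E = Iio n) (hs : IsStrict P Q n) {q : ℕ}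
    (hq : q ∉ Q) (hq' : q + 1 ∈ Q) :
    Iio (q + 1) ∈ cyclicFlats M ∧ M.eRk (Iio (q + 1)) = cnt Q (q + 1) := by
  obtain ⟨h0, hn⟩ := h.two_le_of_right hE hs hq hq'
  have hsw := h.hasSwaps_right hE hs hq hq'
  have hsub : Iio (q + 1) ⊆ M.E := hE ▸ Iio_subset_Iio (by omega)
  refine mem_cyclicFlats_of_isBase h.finite hsub ⟨q, by simp⟩
    (fun B hB => ((h.isBase_iff B hB.subset_ground).1 hB _).2) (fun e he => ?_) (fun e he => ?_)
  · exact (hsw.exists_mem_notMem h0 hn (hE ▸ hsub he : e ∈ Iio n)).2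
  · exact (hsw.exists_mem_notMem h0 hn (hE ▸ he.1 : e ∈ Iio n)).1

theorem IsLP.ncard_isBase (h : IsLP M P Q) {B : Set ℕ} (hB : M.IsBase B) :
    B.ncard = Q.ncard := by
  rw [ncard, ncard, hB.encard_eq_encard_of_isBase h.isBase_right]

theorem IsLP.cnt_add_ncard_Ico_of_isBase (h : IsLP M P Q) (hE : M.E = Iio n) {B : Set ℕ}
    (hB : M.IsBase B) {k : ℕ} (hk : k ≤ n) : cnt B k + (B ∩ Ico k n).ncard = Q.ncard := by
  rw [cnt_add_ncard_inter_Ico B hk, cnt_eq_ncard (hE ▸ hB.subset_ground),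
    h.ncard_isBase hB]

theorem IsLP.Ico_mem_cyclicFlats (h : IsLP M P Q) (hE : M.E = Iio n) (hs : IsStrict P Q n) {q : ℕ}
    (hqn : q + 1 < n) (hq : q ∈ P) (hq' : q + 1 ∉ P) :
    Ico (q + 1) n ∈ cyclicFlats M ∧
      M.eRk (Ico (q + 1) n) = (Q.ncard - cnt P (q + 1) : ℕ) := by
  obtain ⟨h0, hn⟩ := h.two_le_of_left hE hs hqn hq hq'
  have hsw := h.hasSwaps_left hE hs hq hq'
  have hsub : Ico (q + 1) n ⊆ M.E := hE ▸ Ico_subset_Iio_self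
  refine mem_cyclicFlats_of_isBase h.finite hsub ⟨q + 1, by simpa using hqn⟩
    (fun B hB => ?_) (fun e he => ?_) (fun e he => ?_)
  · have := ((h.isBase_iff B hB.subset_ground).1 hB (q + 1)).1
    have := h.cnt_add_ncard_Ico_of_isBase hE hB hqn.le
    omega
  · obtain ⟨B, hB, hc, heB⟩ := (hsw.exists_mem_notMem h0 hn (hE ▸ hsub he : e ∈ Iio n)).2
    have := h.cnt_add_ncard_Ico_of_isBase hE hB hqn.le
    exact ⟨B, hB, by omega, heB⟩
  · obtain ⟨B, hB, hc, heB⟩ := (hsw.exists_mem_notMem h0 hn (hE ▸ he.1 : e ∈ Iio n)).1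
    have := h.cnt_add_ncard_Ico_of_isBase hE hB hqn.le
    exact ⟨B, hB, by omega, heB⟩

end Swaps

/-! ### The structure of cyclic flats -/

section Structure

theorem IsSep.eRk_add_eRk {α : Type*} {M : Matroid α} {y : Set α} (h : IsSep M y) :
    M.eRk y + M.eRk (M.E \ y) = M.eRank := by
  obtain ⟨B, hB⟩ := M.exists_isBase
  have h1 := h.isBasis_inter hB
  have h2 := h.compl.isBasis_inter hB
  rw [← inter_sdiff_assoc, inter_eq_left.2 hB.subset_ground] at h2
  rw [← h1.encard_eq_eRk, ← h2.encard_eq_eRk, ← hB.encard_eq_eRank,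
    ← encard_union_eq disjoint_sdiff_inter.symm, inter_union_sdiff]

variable {M : Matroid ℕ} {P Q : Set ℕ} {n : ℕ}

/-- By minimality a circuit lies inside any interval whose inequality it violates. Replacing `a` by
an element in between keeps the count in that interval, hence the violation. -/
theorem IsLP.mem_closure_of_isCircuit (h : IsLP M P Q) (hE : M.E = Iio n) {C : Set ℕ}
    (hC : M.IsCircuit C) {a g c : ℕ} (ha : a ∈ C) (hc : c ∈ C) (hag : a ≤ g) (hgc : g ≤ c) :
    g ∈ M.closure C := by
  have hCE := hC.subset_ground
  have hCfin := h.finite.subset hCE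
  have hgE : g ∈ M.E := by
    have := hCE hc
    rw [hE, mem_Iio] at this ⊢
    omega
  have hni := hC.not_indep
  rw [h.indep_iff hE] at hni
  push Not at hni
  obtain ⟨a', b', hab, hlt⟩ := hni
  have hCI : C ∩ Ico a' b' = C := by
    refine hC.eq_of_not_indep_subset ?_ inter_subset_left
    rw [h.indep_iff hE]
    intro hcon
    have := hcon a' b' hab
    rw [inter_assoc, inter_self] at this
    omega
  have hga : g ∈ Ico a' b' := by
    have h1 := (hCI.symm ▸ ha : a ∈ C ∩ Ico a' b').2
    have h2 := (hCI.symm ▸ hc : c ∈ C ∩ Ico a' b').2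
    simp only [mem_Ico] at h1 h2 ⊢
    omega
  by_contra hg
  have hgC : g ∉ C := fun h' => hg (M.mem_closure_of_mem h' hCE)
  have hI : M.Indep (insert g (C \ {a})) := by
    rw [(hC.sdiff_singleton_indep ha).insert_indep_iff_of_notMem (fun h' => hgC h'.1),
      hC.closure_sdiff_singleton_eq]
    exact ⟨hgE, hg⟩
  have h1 := (h.indep_iff hE).1 hI a' b' hab
  have h2 : insert g (C \ {a}) ∩ Ico a' b' = insert g (C \ {a}) := by
    rw [inter_eq_left]
    exact insert_subset hga (sdiff_subset.trans (inter_eq_left.1 hCI))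
  rw [h2, ncard_insert_of_notMem (fun h' => hgC h'.1) (hCfin.subset sdiff_subset),
    ncard_sdiff_singleton_add_one ha hCfin, ← hCI] at h1
  omega

/-- A circuit inside the flat `X` cannot have elements on both sides of `g`, since it would span
`g`. So the gap splits the restriction to `X`. -/
theorem IsLP.split_of_gap (h : IsLP M P Q) (hE : M.E = Iio n) (hl : M.loops = ∅) {X : Set ℕ}
    (hX : X ∈ cyclicFlats M) {g : ℕ} (hg : g ∉ X) :
    X ∩ Iio g ∈ cyclicFlats M ∧ X ∩ Ioi g ∈ cyclicFlats M ∧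
      M.eRk (X ∩ Iio g) + M.eRk (X ∩ Ioi g) = M.eRk X := by
  have hXE := hX.1.subset_ground
  have hsep : IsSep (M ↾ X) (X ∩ Iio g) := by
    refine ⟨inter_subset_left, fun I hI h1 h2 => ?_⟩
    rw [Matroid.restrict_ground_eq] at hI
    rw [Matroid.restrict_indep_iff] at *
    refine ⟨?_, hI⟩
    by_contra hnI
    obtain ⟨C, hCI, hC⟩ := Matroid.Dep.exists_isCircuit_subset ⟨hnI, hI.trans hXE⟩
    by_cases hlt : ∃ a ∈ C, a < g
    · obtain ⟨a, ha, hag⟩ := hlt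
      refine hC.not_indep (h1.1.subset fun c hc => ⟨hCI hc, hI (hCI hc), ?_⟩)
      rw [mem_Iio]
      by_contra! hgc
      refine hg ?_
      rw [← hX.1.closure]
      exact M.closure_subset_closure (hCI.trans hI)
        (h.mem_closure_of_isCircuit hE hC ha hc hag.le hgc)
    · push Not at hlt
      refine hC.not_indep (h2.1.subset fun c hc => ⟨hCI hc, fun h' => ?_⟩)
      exact absurd (hlt c hc) (not_le.2 h'.2)
  have hcompl : (M ↾ X).E \ (X ∩ Iio g) = X ∩ Ioi g := by
    rw [Matroid.restrict_ground_eq]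
    ext e
    simp only [mem_sdiff, mem_inter_iff, mem_Iio, mem_Ioi, not_and, not_lt]
    constructor
    · rintro ⟨h1, h2⟩
      exact ⟨h1, lt_of_le_of_ne (h2 h1) fun h' => hg (h' ▸ h1)⟩
    · rintro ⟨h1, h2⟩
      exact ⟨h1, fun _ => h2.le⟩
  have hl' : (M ↾ X).loops = ∅ := by rw [Matroid.restrict_loops_eq hXE, hl, empty_inter]
  have hcyc : IsCyclicSet (M ↾ X) (M ↾ X).E :=
    ((mem_cyclicFlats_restrict_iff hX.1).2 ⟨hX, Subset.rfl⟩).2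
  refine ⟨((mem_cyclicFlats_restrict_iff hX.1).1 (hsep.mem_cyclicFlats hl' hcyc)).1,
    ((mem_cyclicFlats_restrict_iff hX.1).1 (hcompl ▸ hsep.compl.mem_cyclicFlats hl' hcyc)).1, ?_⟩
  have := hsep.eRk_add_eRk
  rw [hcompl, M.restrict_eRk_eq inter_subset_left, M.restrict_eRk_eq inter_subset_left,
    M.eRank_restrict] at this
  exact this

/-- If `e ∉ K`, an interval violated by `K` with `e` added is tight for `K`. If `e ∈ K`, exchange
`e` for some `f ∈ X`: the interval violated by adding `f` must contain `e`, or the exchange would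
violate it too. -/
theorem IsLP.tight_of_isBasis (h : IsLP M P Q) (hE : M.E = Iio n) {X K : Set ℕ}
    (hX : IsCyclicSet M X) (hK : M.IsBasis K X) {e : ℕ} (he : e ∈ X) :
    ∃ c d, e ∈ Ico c d ∧ (K ∩ Ico c d).ncard + cnt P c = cnt Q d := by
  have hXE := hX.subset_ground
  have key : ∀ f ∈ X, f ∉ K → ∃ c d, f ∈ Ico c d ∧ (K ∩ Ico c d).ncard + cnt P c = cnt Q d ∧
      cnt Q d < (insert f K ∩ Ico c d).ncard + cnt P c := by
    intro f hf hfK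
    have hdep := (hK.insert_dep ⟨hf, hfK⟩).not_indep
    rw [h.indep_iff hE] at hdep
    push Not at hdep
    obtain ⟨c, d, hcd, hlt⟩ := hdep
    have hKi := (h.indep_iff hE).1 hK.indep c d hcd
    have hfi : f ∈ Ico c d := by
      by_contra hfi
      rw [insert_inter_of_notMem hfi] at hlt
      omega
    refine ⟨c, d, hfi, ?_, hlt⟩
    rw [insert_inter_of_mem hfi] at hlt
    have := ncard_insert_le f (K ∩ Ico c d)
    omega
  by_cases heK : e ∈ K
  · have hecl := isCyclicSet_iff_mem_closure.1 hX e he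
    obtain ⟨f, hf, hfcl⟩ : ∃ f ∈ X \ {e}, f ∉ M.closure (K \ {e}) := by
      by_contra! hcon
      exact hK.indep.notMem_closure_sdiff_of_mem heK
        (M.closure_subset_closure_of_subset_closure hcon hecl)
    have hfK : f ∉ K := fun h' => hfcl (M.mem_closure_of_mem (X := K \ {e}) ⟨h', hf.2⟩
      (sdiff_subset.trans hK.indep.subset_ground))
    obtain ⟨c, d, hfi, htight, hlt⟩ := key f hf.1 hfK
    refine ⟨c, d, ?_, htight⟩
    by_contra hei
    have hI : M.Indep (insert f (K \ {e})) := by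
      rw [(hK.indep.subset sdiff_subset).insert_indep_iff_of_notMem (fun h' => hfK h'.1)]
      exact ⟨hXE hf.1, hfcl⟩
    have h1 := (h.indep_iff hE).1 hI c d (by simp only [mem_Ico] at hfi; omega)
    have h2 : insert f (K \ {e}) ∩ Ico c d = insert f K ∩ Ico c d := by
      rw [insert_inter_of_mem hfi, insert_inter_of_mem hfi]
      congr 1
      ext j
      refine ⟨fun hj => ⟨hj.1.1, hj.2⟩, fun hj => ⟨⟨hj.1, fun h' => hei ?_⟩, hj.2⟩⟩
      rw [mem_singleton_iff] at h'
      exact h' ▸ hj.2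
    rw [h2] at h1
    omega
  · obtain ⟨c, d, h1, h2, -⟩ := key e he heK
    exact ⟨c, d, h1, h2⟩

/-- No tight interval contains an element outside the flat, as `K` would span it. So tight intervals
inside `[a, b)` cover it, and uncrossing merges them into `[a, b)` itself. -/
theorem IsLP.ncard_add_cnt_of_Ico (h : IsLP M P Q) (hE : M.E = Iio n) {a b : ℕ} (ha : 0 < a)
    (hab : a < b) (hbn : b < n) (hX : Ico a b ∈ cyclicFlats M) {K : Set ℕ}
    (hK : M.IsBasis K (Ico a b)) : K.ncard + cnt P a = cnt Q b := by
  have hind := (h.indep_iff hE).1 hK.indep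
  have hKfin := h.finite.subset hK.indep.subset_ground
  have hout : ∀ g < n, g ∉ Ico a b → ∀ c d, g ∈ Ico c d →
      (K ∩ Ico c d).ncard + cnt P c ≠ cnt Q d := by
    intro g hgn hg c d hgi heq
    have hgcl : g ∉ M.closure K := by rwa [hK.closure_eq_closure, hX.1.closure]
    have hgK : g ∉ K := fun h' => hg (hK.subset h')
    have hI : M.Indep (insert g K) := by
      rw [hK.indep.insert_indep_iff_of_notMem hgK]
      exact ⟨hE ▸ hgn, hgcl⟩
    have h1 := (h.indep_iff hE).1 hI c d (by simp only [mem_Ico] at hgi; omega)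
    rw [insert_inter_of_mem hgi, ncard_insert_of_notMem (fun h' => hgK h'.1)
      (hKfin.subset inter_subset_left)] at h1
    omega
  have hbd : ∀ e ∈ Ico a b, ∃ c d, a ≤ c ∧ c ≤ e ∧ e < d ∧ d ≤ b ∧
      (K ∩ Ico c d).ncard + cnt P c = cnt Q d := by
    intro e he
    obtain ⟨c, d, hei, heq⟩ := h.tight_of_isBasis hE hX.2 hK he
    simp only [mem_Ico] at he hei
    refine ⟨c, d, ?_, hei.1, hei.2, ?_, heq⟩
    · by_contra hca
      exact hout (a - 1) (by omega) (by simp only [mem_Ico]; omega) c d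
        (by simp only [mem_Ico]; omega) heq
    · by_contra hdb
      exact hout b hbn (by simp) c d (by simp only [mem_Ico]; omega) heq
  have main : ∀ j, a ≤ j → j < b → ∃ d, j < d ∧ d ≤ b ∧
      (K ∩ Ico a d).ncard + cnt P a = cnt Q d := by
    intro j haj
    induction j, haj using Nat.le_induction with
    | base =>
      intro _
      obtain ⟨c, d, h1, h2, h3, h4, h5⟩ := hbd a (by simp only [mem_Ico]; omega)
      obtain rfl : c = a := by omega
      exact ⟨d, h3, h4, h5⟩
    | succ j haj ih =>
      intro hjb
      obtain ⟨d, h1, h2, h3⟩ := ih (by omega)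
      rcases Nat.lt_or_ge (j + 1) d with hd | hd
      · exact ⟨d, hd, h2, h3⟩
      · obtain rfl : d = j + 1 := by omega
        obtain ⟨c', d', g1, g2, g3, g4, g5⟩ := hbd (j + 1) (by simp only [mem_Ico]; omega)
        refine ⟨d', g3, g4, ?_⟩
        -- Uncrossing: the counts on `[a, d')` and `[c', j + 1)` add up to those on the tight `[a, j
        -- + 1)` and `[c', d')`, so their inequalities are equalities.
        have e1 := hind a d' (by omega)
        have e2 := hind c' (j + 1) g2
        have f1 := cnt_add_ncard_inter_Ico K (show a ≤ j + 1 by omega)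
        have f2 := cnt_add_ncard_inter_Ico K (show c' ≤ d' by omega)
        have f3 := cnt_add_ncard_inter_Ico K (show a ≤ d' by omega)
        have f4 := cnt_add_ncard_inter_Ico K g2
        omega
  obtain ⟨d, h1, h2, h3⟩ := main (b - 1) (by omega) (by omega)
  obtain rfl : d = b := by omega
  rwa [inter_eq_left.2 hK.subset] at h3

/-- Flatness lets a neighbour be added to a basis, which forces the north steps `p ∈ P` and `q + 1 ∈
Q`. Cyclicity lets a basis avoid an end element, which forbids `p + 1 ∈ P` and `q ∈ Q`. -/
theorem IsLP.corners_of_Ico (h : IsLP M P Q) (hE : M.E = Iio n) {p q : ℕ}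
    (hpq : p < q) (hqn : q + 1 < n) (hX : Ico (p + 1) (q + 1) ∈ cyclicFlats M) :
    p ∈ P ∧ p + 1 ∉ P ∧ q ∉ Q ∧ q + 1 ∈ Q ∧
      M.eRk (Ico (p + 1) (q + 1)) + cnt P (p + 1) = cnt Q (q + 1) := by
  have hXE := hX.1.subset_ground
  have htight : ∀ {K}, M.IsBasis K (Ico (p + 1) (q + 1)) → K.ncard + cnt P (p + 1) = cnt Q (q + 1) :=
    fun hK => h.ncard_add_cnt_of_Ico hE (by omega) (by omega) hqn hX hK
  obtain ⟨K, hK⟩ := M.exists_isBasis (Ico (p + 1) (q + 1))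
  have hKn := htight hK
  have hKfin := h.finite.subset hK.indep.subset_ground
  have hins : ∀ g < n, g ∉ Ico (p + 1) (q + 1) → ∀ c d, c ≤ d → Ico (p + 1) (q + 1) ⊆ Ico c d →
      g ∈ Ico c d → K.ncard + 1 + cnt P c ≤ cnt Q d := by
    intro g hgn hg c d hcd hsub hgi
    have hgK : g ∉ K := fun h' => hg (hK.subset h')
    have hI : M.Indep (insert g K) := by
      rw [hK.indep.insert_indep_iff_of_notMem hgK, hK.closure_eq_closure, hX.1.closure]
      exact ⟨hE ▸ hgn, hg⟩
    have h1 := (h.indep_iff hE).1 hI c d hcd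
    rwa [inter_eq_left.2 (insert_subset hgi (hK.subset.trans hsub)),
      ncard_insert_of_notMem hgK hKfin] at h1
  have hdel : ∀ e ∈ Ico (p + 1) (q + 1), ∃ K', M.IsBasis K' (Ico (p + 1) (q + 1)) ∧ e ∉ K' := by
    intro e he
    obtain ⟨K', hK'⟩ := M.exists_isBasis (Ico (p + 1) (q + 1) \ {e}) (sdiff_subset.trans hXE)
    refine ⟨K', ?_, fun h' => (hK'.subset h').2 rfl⟩
    refine hK'.isBasis_of_closure_eq_closure (hK'.subset.trans sdiff_subset) ?_ hXE
    exact M.closure_sdiff_singleton_eq_closure (isCyclicSet_iff_mem_closure.1 hX.2 e he)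
  refine ⟨?_, ?_, ?_, ?_, ?_⟩
  · by_contra hp
    have h1 := hins p (by omega) (by simp) p (q + 1) (by omega) (Ico_subset_Ico_left (by omega))
      (by simp only [mem_Ico]; omega)
    have h2 := cnt_succ_of_notMem hp
    omega
  · intro hp
    obtain ⟨K', hK', hpK⟩ := hdel (p + 1) (by simp only [mem_Ico]; omega)
    have h1 := (h.indep_iff hE).1 hK'.indep (p + 2) (q + 1) (by omega)
    have h2 := cnt_succ_of_mem hp
    have h3 := htight hK'
    rw [inter_eq_left.2] at h1
    · rw [show p + 1 + 1 = p + 2 from rfl] at h2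
      omega
    · intro j hj
      have h4 := hK'.subset hj
      have h5 : j ≠ p + 1 := fun h' => hpK (h' ▸ hj)
      simp only [mem_Ico] at h4 ⊢
      omega
  · intro hq
    obtain ⟨K', hK', hqK⟩ := hdel q (by simp only [mem_Ico]; omega)
    have h1 := (h.indep_iff hE).1 hK'.indep (p + 1) q (by omega)
    have h2 := cnt_succ_of_mem hq
    have h3 := htight hK'
    rw [inter_eq_left.2] at h1
    · omega
    · intro j hj
      have h4 := hK'.subset hj
      have h5 : j ≠ q := fun h' => hqK (h' ▸ hj)
      simp only [mem_Ico] at h4 ⊢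
      omega
  · by_contra hq
    have h1 := hins (q + 1) hqn (by simp) (p + 1) (q + 2) (by omega)
      (Ico_subset_Ico_right (by omega)) (by simp only [mem_Ico]; omega)
    have h2 := cnt_succ_of_notMem hq
    rw [show q + 1 + 1 = q + 2 from rfl] at h2
    omega
  · rw [← hK.encard_eq_eRk, ← hKfin.cast_ncard_eq]
    exact_mod_cast hKn

end Structure

/-! ### Bases are determined by the corners of the bounding paths -/

section Corners

variable {X Y : Set ℕ} {n : ℕ}

/-- The excess of `X` over `Y` does not shrink to the right along east steps of `Y`, nor to the left
along its north steps. Go right to a north step, then left to the start of its run. -/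
theorem exists_corner_of_cnt_lt (hX : X ⊆ Iio n) (hY : Y ⊆ Iio n) (hXY : X.ncard = Y.ncard)
    {k : ℕ} (hk : cnt Y k < cnt X k) : ∃ q, q ∉ Y ∧ q + 1 ∈ Y ∧ cnt Y (q + 1) < cnt X (q + 1) := by
  have left : ∀ k, k ∈ Y → cnt Y k < cnt X k →
      ∃ q, q ∉ Y ∧ q + 1 ∈ Y ∧ cnt Y (q + 1) < cnt X (q + 1) := by
    intro k
    induction k with
    | zero => intro _ h; simp at h
    | succ k ih =>
      intro hk hlt
      by_cases hkY : k ∈ Y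
      · have h1 := cnt_succ_of_mem hkY
        have h2 := cnt_succ_le X k
        exact ih hkY (by omega)
      · exact ⟨k, hkY, hk, hlt⟩
  have right : ∀ d k, k + d = n → cnt Y k < cnt X k → ∃ k, k ∈ Y ∧ cnt Y k < cnt X k := by
    intro d
    induction d with
    | zero =>
      rintro k rfl hlt
      rw [add_zero] at hX hY
      rw [cnt_eq_ncard hX, cnt_eq_ncard hY] at hlt
      omega
    | succ d ih =>
      intro k hkd hlt
      by_cases hkY : k ∈ Y
      · exact ⟨k, hkY, hlt⟩
      · have h1 := cnt_succ_of_notMem hkY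
        have h2 := cnt_mono X (Nat.le_succ k)
        exact ih (k + 1) (by omega) (by rw [h1]; exact lt_of_lt_of_le hlt h2)
  have hkn : k ≤ n := by
    by_contra! hkn
    rw [cnt_eq_ncard (hX.trans (Iio_subset_Iio hkn.le)),
      cnt_eq_ncard (hY.trans (Iio_subset_Iio hkn.le))] at hk
    omega
  obtain ⟨k', h1, h2⟩ := right (n - k) k (by omega) hk
  exact left k' h1 h2

/-- The mirror argument: back over east steps of `Y` to a north step, then forward to the end of its
run. The equal totals keep the corner before `n`. -/
theorem exists_corner_of_lt_cnt (hX : X ⊆ Iio n) (hY : Y ⊆ Iio n) (hXY : X.ncard = Y.ncard)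
    {k : ℕ} (hk : cnt X k < cnt Y k) :
    ∃ q, q + 1 < n ∧ q ∈ Y ∧ q + 1 ∉ Y ∧ cnt X (q + 1) < cnt Y (q + 1) := by
  have hlt_n : ∀ k, cnt X k < cnt Y k → k < n := by
    intro k hk
    by_contra! hkn
    rw [cnt_eq_ncard (hX.trans (Iio_subset_Iio hkn)),
      cnt_eq_ncard (hY.trans (Iio_subset_Iio hkn))] at hk
    omega
  have right : ∀ d k, k + 1 + d = n → k ∈ Y → cnt X (k + 1) < cnt Y (k + 1) →
      ∃ q, q + 1 < n ∧ q ∈ Y ∧ q + 1 ∉ Y ∧ cnt X (q + 1) < cnt Y (q + 1) := by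
    intro d
    induction d with
    | zero =>
      intro k hkn hkY hlt
      have := hlt_n _ hlt
      omega
    | succ d ih =>
      intro k hkd hkY hlt
      by_cases hkY' : k + 1 ∈ Y
      · have h1 := cnt_succ_of_mem hkY'
        have h2 := cnt_succ_le X (k + 1)
        exact ih (k + 1) (by omega) hkY' (by omega)
      · exact ⟨k, by omega, hkY, hkY', hlt⟩
  have left : ∀ k, cnt X k < cnt Y k → ∃ q, q ∈ Y ∧ cnt X (q + 1) < cnt Y (q + 1) := by
    intro k
    induction k with
    | zero => intro h; simp at h
    | succ k ih =>
      intro hlt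
      by_cases hkY : k ∈ Y
      · exact ⟨k, hkY, hlt⟩
      · have h1 := cnt_succ_of_notMem hkY
        have h2 := cnt_mono X (Nat.le_succ k)
        rw [Nat.succ_eq_add_one] at h2
        exact ih (by omega)
  obtain ⟨q, h1, h2⟩ := left k hk
  have := hlt_n _ h2
  exact right (n - (q + 1)) q (by omega) h1 h2

end Corners

/-! ### Fundamental elements of a configuration -/

section Fundamental

variable {L : Type*} [Lattice L]

/-- `s` and `ρ` are modular on the pair `y`, `z`. -/
def IsModularPair (s ρ : L → ℕ) (y z : L) : Prop :=
  s y + s z = s (y ⊔ z) + s (y ⊓ z) ∧ ρ y + ρ z = ρ (y ⊔ z) + ρ (y ⊓ z)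

/-- The interval from `b` to `x` reflects a direct sum decomposition of a restriction. -/
def Decomposes (s ρ : L → ℕ) (b x : L) : Prop :=
  ∃ y z, y ≠ x ∧ z ≠ x ∧ y ⊔ z = x ∧ y ⊓ z = b ∧ IsModularPair s ρ y z

/-- The interval from `x` to `t` reflects a direct sum decomposition of a contraction. -/
def Codecomposes (s ρ : L → ℕ) (x t : L) : Prop :=
  ∃ y z, y ≠ x ∧ z ≠ x ∧ y ⊔ z = t ∧ y ⊓ z = x ∧ IsModularPair s ρ y z

/-- `x` corresponds to a proper nonempty cyclic flat for which the restriction and the contraction are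
indecomposable. -/
def IsFundamental (s ρ : L → ℕ) (b t x : L) : Prop :=
  x ≠ b ∧ x ≠ t ∧ ¬ Decomposes s ρ b x ∧ ¬ Codecomposes s ρ x t

variable {s ρ : L → ℕ} {b t x y z w : L}

theorem IsConfig.isModularPair {α : Type*} {M : Matroid α} {φ : L → Set α} (h : IsConfig M s ρ φ)
    (hx : φ y ∪ φ z = φ x) (hw : φ y ∩ φ z = φ w) (hρ : ρ y + ρ z = ρ x + ρ w) :
    y ⊔ z = x ∧ y ⊓ z = w ∧ IsModularPair s ρ y z := by
  have h1 : y ⊔ z = x := by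
    refine le_antisymm (sup_le ?_ ?_) ?_
    · rw [← h.subset_iff, ← hx]; exact subset_union_left
    · rw [← h.subset_iff, ← hx]; exact subset_union_right
    · rw [← h.subset_iff, ← hx]
      exact union_subset ((h.subset_iff _ _).2 le_sup_left) ((h.subset_iff _ _).2 le_sup_right)
  have h2 : y ⊓ z = w := by
    refine le_antisymm ?_ (le_inf ?_ ?_)
    · rw [← h.subset_iff, ← hw]
      exact subset_inter ((h.subset_iff _ _).2 inf_le_left) ((h.subset_iff _ _).2 inf_le_right)
    · rw [← h.subset_iff, ← hw]; exact inter_subset_left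
    · rw [← h.subset_iff, ← hw]; exact inter_subset_right
  refine ⟨h1, h2, ?_, by rw [h1, h2, hρ]⟩
  rw [h1, h2, ← h.ncard_eq, ← h.ncard_eq, ← h.ncard_eq, ← h.ncard_eq, ← hx, ← hw,
    ncard_union_add_ncard_inter _ _ (h.finite y) (h.finite z)]

theorem IsConfig.rank_eq_zero {α : Type*} {M : Matroid α} {φ : L → Set α} (h : IsConfig M s ρ φ)
    (hb : φ b = ∅) : ρ b = 0 := by
  have := h.eRk_eq b
  rw [hb, M.eRk_empty] at this
  exact_mod_cast this.symm

theorem IsConfig.loops_eq_empty {α : Type*} {M : Matroid α} {φ : L → Set α}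
    (h : IsConfig M s ρ φ) (hb : φ b = ∅) : M.loops = ∅ := by
  rw [← subset_empty_iff, ← hb, ← (h.isFlat b).closure]
  exact M.closure_subset_closure (empty_subset _)

/-- `φ` presents the cyclic flats of a lattice path matroid on `{0, …, n - 1}` that has no loops and no
coloops and cannot be decomposed. -/
structure IsConnectedLP (M : Matroid ℕ) (P Q : Set ℕ) (n : ℕ) (s ρ : L → ℕ) (b t : L)
    (φ : L → Set ℕ) : Prop where
  isLP : IsLP M P Q
  ground_eq : M.E = Iio n
  isConfig : IsConfig M s ρ φ
  bot_eq : φ b = ∅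
  top_eq : φ t = M.E
  not_decomposes : ¬ Decomposes s ρ b t

namespace IsConnectedLP

variable {M : Matroid ℕ} {P Q : Set ℕ} {n : ℕ} {φ : L → Set ℕ}

theorem rank_top (h : IsConnectedLP M P Q n s ρ b t φ) {B : Set ℕ} (hB : M.IsBase B) :
    B.ncard = ρ t := by
  have h1 := h.isConfig.eRk_eq t
  rw [h.top_eq, M.eRk_ground, ← hB.encard_eq_eRank,
    ← (h.isLP.finite.subset hB.subset_ground).cast_ncard_eq] at h1
  exact_mod_cast h1

theorem size_top (h : IsConnectedLP M P Q n s ρ b t φ) : s t = n := by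
  rw [← h.isConfig.ncard_eq, h.top_eq, h.ground_eq]
  simp

theorem isStrict (h : IsConnectedLP M P Q n s ρ b t φ) : IsStrict P Q n := by
  intro k hk hkn
  refine lt_of_le_of_ne (h.isLP.cnt_le_cnt k) fun heq => h.not_decomposes ?_
  have hsep := isSep_Iio h.isLP h.ground_eq hkn.le heq
  have hl := h.isConfig.loops_eq_empty h.bot_eq
  have hcyc : IsCyclicSet M M.E := h.top_eq ▸ (h.isConfig.mem t).2
  obtain ⟨y, hy⟩ := (h.isConfig.mem_iff _).1 (hsep.mem_cyclicFlats hl hcyc)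
  obtain ⟨z, hz⟩ := (h.isConfig.mem_iff _).1 (hsep.compl.mem_cyclicFlats hl hcyc)
  have hrk := hsep.eRk_add_eRk
  have hρ : ρ y + ρ z = ρ t + ρ b := by
    rw [h.isConfig.rank_eq_zero h.bot_eq]
    rw [← hz, ← hy, h.isConfig.eRk_eq, h.isConfig.eRk_eq, ← M.eRk_ground, ← h.top_eq,
      h.isConfig.eRk_eq] at hrk
    exact_mod_cast hrk
  obtain ⟨h1, h2, h3⟩ := h.isConfig.isModularPair (x := t) (w := b)
    (by rw [hy, hz, h.top_eq, union_sdiff_cancel hsep.1])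
    (by rw [hy, hz, h.bot_eq, inter_sdiff_self]) hρ
  refine ⟨y, z, ?_, ?_, h1, h2, h3⟩
  · rintro rfl
    have : k ∈ Iio k := by rw [← hy, h.top_eq, h.ground_eq]; exact hkn
    simp at this
  · rintro rfl
    have : 0 ∈ M.E \ Iio k := by rw [← hz, h.top_eq, h.ground_eq]; exact mem_Iio.2 (by omega)
    exact this.2 hk

theorem mem_of_between (h : IsConnectedLP M P Q n s ρ b t φ) (hx : ¬ Decomposes s ρ b x)
    {a g c : ℕ} (ha : a ∈ φ x) (hc : c ∈ φ x) (hag : a ≤ g) (hgc : g ≤ c) : g ∈ φ x := by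
  by_contra hg
  have hga : a ≠ g := fun h' => hg (h' ▸ ha)
  have hgc' : g ≠ c := fun h' => hg (h' ▸ hc)
  obtain ⟨h1, h2, h3⟩ := h.isLP.split_of_gap h.ground_eq (h.isConfig.loops_eq_empty h.bot_eq)
    (h.isConfig.mem x) hg
  obtain ⟨y, hy⟩ := (h.isConfig.mem_iff _).1 h1
  obtain ⟨z, hz⟩ := (h.isConfig.mem_iff _).1 h2
  have hρ : ρ y + ρ z = ρ x + ρ b := by
    rw [h.isConfig.rank_eq_zero h.bot_eq]
    rw [← hy, ← hz, h.isConfig.eRk_eq, h.isConfig.eRk_eq, h.isConfig.eRk_eq] at h3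
    exact_mod_cast h3
  have hunion : φ y ∪ φ z = φ x := by
    rw [hy, hz, ← inter_union_distrib_left, inter_eq_left]
    intro e he
    rcases lt_trichotomy e g with h' | h' | h'
    · exact Or.inl h'
    · exact absurd (h' ▸ he) hg
    · exact Or.inr h'
  have hinter : φ y ∩ φ z = φ b := by
    rw [hy, hz, h.bot_eq, eq_empty_iff_forall_notMem]
    rintro e ⟨⟨-, h4⟩, -, h5⟩
    rw [mem_Iio] at h4
    rw [mem_Ioi] at h5
    omega
  obtain ⟨e1, e2, e3⟩ := h.isConfig.isModularPair hunion hinter hρ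
  refine hx ⟨y, z, ?_, ?_, e1, e2, e3⟩
  · rintro rfl
    have := (hy ▸ hc : c ∈ φ y ∩ Iio g).2
    rw [mem_Iio] at this
    omega
  · rintro rfl
    have := (hz ▸ ha : a ∈ φ z ∩ Ioi g).2
    rw [mem_Ioi] at this
    omega

theorem ncard_pos_and_lt (h : IsConnectedLP M P Q n s ρ b t φ) (hb : x ≠ b) (ht : x ≠ t) :
    0 < s x ∧ s x < n := by
  rw [← h.isConfig.ncard_eq]
  constructor
  · rw [ncard_pos (h.isConfig.finite x), nonempty_iff_ne_empty, ← h.bot_eq]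
    exact fun h' => hb (h.isConfig.injective h')
  · rw [← h.size_top, ← h.isConfig.ncard_eq]
    refine ncard_lt_ncard (ssubset_iff_subset_ne.2 ⟨?_, fun h' => ht (h.isConfig.injective h')⟩)
      (h.isConfig.finite t)
    rw [h.top_eq]
    exact h.isConfig.subset_ground x

/-- A fundamental element corresponds to an initial or to a final segment. -/
theorem eq_Iio_or_eq_Ico (h : IsConnectedLP M P Q n s ρ b t φ) (hx : IsFundamental s ρ b t x) :
    φ x = Iio (s x) ∨ φ x = Ico (n - s x) n := by
  obtain ⟨hxb, hxt, hdec, hcodec⟩ := hx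
  have hpos := (h.ncard_pos_and_lt hxb hxt).1
  have hcard := h.isConfig.ncard_eq x
  have hne : (φ x).Nonempty := (ncard_pos (h.isConfig.finite x)).1 (by omega)
  obtain ⟨a, ha, hamin⟩ := exists_min_image (φ x) id (h.isConfig.finite x) hne
  obtain ⟨c, hc, hcmax⟩ := exists_max_image (φ x) id (h.isConfig.finite x) hne
  have hX : φ x = Ico a (c + 1) := by
    ext e
    rw [mem_Ico]
    constructor
    · intro he
      have h1 := hamin e he
      have h2 := hcmax e he
      simp only [id] at h1 h2
      omega
    · intro he
      exact h.mem_of_between hdec ha hc he.1 (by omega)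
  have hac : a ≤ c := hamin c hc
  have hcn : c < n := by
    have := h.isConfig.subset_ground x hc
    rwa [h.ground_eq] at this
  have hsx : s x = c + 1 - a := by
    rw [← hcard, hX, ← Finset.coe_Ico, ncard_coe_finset, Nat.card_Ico]
  rcases Nat.eq_zero_or_pos a with rfl | hapos
  · left
    rw [hX, hsx]
    ext e; simp
  rcases Nat.lt_or_ge (c + 1) n with hcn' | hcn'
  · exfalso
    obtain ⟨p, rfl⟩ : ∃ p, a = p + 1 := ⟨a - 1, by omega⟩
    have hmem := h.isConfig.mem x
    rw [hX] at hmem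
    obtain ⟨hp, hp', hq, hq', hrk⟩ := h.isLP.corners_of_Ico h.ground_eq (by omega) hcn' hmem
    -- For an interval touching neither end, the initial and final segments at its corners are
    -- cyclic flats that meet in `φ x`, cover the ground set and have modular ranks, so the
    -- contraction would split.
    obtain ⟨hy, hyr⟩ := h.isLP.Iio_mem_cyclicFlats h.ground_eq h.isStrict hq hq'
    obtain ⟨hz, hzr⟩ := h.isLP.Ico_mem_cyclicFlats h.ground_eq h.isStrict (by omega) hp hp'
    obtain ⟨y, hy⟩ := (h.isConfig.mem_iff _).1 hy
    obtain ⟨z, hz⟩ := (h.isConfig.mem_iff _).1 hz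
    rw [← hy, h.isConfig.eRk_eq, Nat.cast_inj] at hyr
    rw [← hz, h.isConfig.eRk_eq, Nat.cast_inj] at hzr
    rw [← hX, h.isConfig.eRk_eq] at hrk
    norm_cast at hrk
    have ht := h.rank_top h.isLP.isBase_right
    have hPQ : cnt P (p + 1) ≤ Q.ncard := by
      rw [← h.isLP.ncard_eq, ← cnt_eq_ncard (h.ground_eq ▸ h.isLP.left_subset)]
      exact cnt_mono P (by omega)
    have hunion : φ y ∪ φ z = φ t := by
      rw [hy, hz, h.top_eq, h.ground_eq]
      ext e; simp only [mem_union, mem_Iio, mem_Ico]; omega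
    have hinter : φ y ∩ φ z = φ x := by
      rw [hy, hz, hX]
      ext e; simp only [mem_inter_iff, mem_Iio, mem_Ico]; omega
    obtain ⟨e1, e2, e3⟩ := h.isConfig.isModularPair hunion hinter (by omega)
    refine hcodec ⟨y, z, ?_, ?_, e1, e2, e3⟩
    · rintro rfl
      have : 0 ∈ Iio (c + 1) := by simp
      rw [← hy, hX, mem_Ico] at this
      omega
    · rintro rfl
      have : n - 1 ∈ Ico (p + 1) n := by rw [mem_Ico]; omega
      rw [← hz, hX, mem_Ico] at this
      omega
  · right
    obtain rfl : n = c + 1 := by omega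
    rw [hX, hsx, Nat.sub_sub_self (by omega)]

/-- In a splitting of the restriction or the contraction, every base with `v` elements before the
cut attains the rank bounds of both parts. The swaps then make each part constant on each side of
the cut, so one part is trivial. -/
theorem isFundamental_of_hasSwaps (h : IsConnectedLP M P Q n s ρ b t φ) {q v : ℕ}
    (hqn : q + 1 < n) (hsw : HasSwaps M n (q + 1) v)
    (hx : φ x = Iio (q + 1) ∨ φ x = Ico (q + 1) n)
    (hval : ∀ B, M.IsBase B → cnt B (q + 1) = v → (B ∩ φ x).ncard = ρ x) :
    IsFundamental s ρ b t x := by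
  have hfin := h.isLP.finite
  have hconst : ∀ Y : Set ℕ, (∀ p, p + 1 < n → p + 1 ≠ q + 1 → (p ∈ Y ↔ p + 1 ∈ Y)) →
      (∀ p, p < q + 1 → (p ∈ Y ↔ 0 ∈ Y)) ∧ ∀ p, q + 1 ≤ p → p < n → (p ∈ Y ↔ q + 1 ∈ Y) := by
    intro Y hY
    constructor
    · intro p hp
      induction p with
      | zero => rfl
      | succ p ih => rw [← ih (by omega), hY p (by omega) (by omega)]
    · intro p hqp
      induction p, hqp using Nat.le_induction with
      | base => intro _; rfl
      | succ p hqp ih =>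
        intro hp
        rw [← ih (by omega), hY p hp (by omega)]
  obtain ⟨e₀, e₁, he₀, he₁, he₁n, hrep⟩ : ∃ e₀ e₁, e₀ ∈ φ x ∧ e₁ ∉ φ x ∧ e₁ < n ∧
      ∀ Y : Set ℕ, (∀ p, p + 1 < n → p + 1 ≠ q + 1 → (p ∈ Y ↔ p + 1 ∈ Y)) →
        (∀ p ∈ φ x, p ∈ Y ↔ e₀ ∈ Y) ∧ ∀ p < n, p ∉ φ x → (p ∈ Y ↔ e₁ ∈ Y) := by
    rcases hx with hx | hx
    · refine ⟨0, q + 1, by simp [hx], by simp [hx], hqn, fun Y hY => ⟨fun p hp => ?_, fun p hpn hp =>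
        ?_⟩⟩
      · rw [hx, mem_Iio] at hp
        exact (hconst Y hY).1 p hp
      · rw [hx, mem_Iio, not_lt] at hp
        exact (hconst Y hY).2 p hp hpn
    · refine ⟨q + 1, 0, by simpa [hx] using hqn, by simp [hx], by omega,
        fun Y hY => ⟨fun p hp => ?_, fun p hpn hp => ?_⟩⟩
      · rw [hx, mem_Ico] at hp
        exact (hconst Y hY).2 p hp.1 hp.2
      · rw [hx, mem_Ico] at hp
        exact (hconst Y hY).1 p (by omega)
  have hle : ∀ y z B, M.IsBase B → (B ∩ φ y).ncard ≤ ρ y ∧ (B ∩ φ z).ncard ≤ ρ z :=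
    fun y z B hB => ⟨h.isConfig.ncard_inter_le hB.indep y, h.isConfig.ncard_inter_le hB.indep z⟩
  refine ⟨?_, ?_, ?_, ?_⟩
  · rintro rfl
    rw [h.bot_eq] at he₀
    exact he₀
  · rintro rfl
    rw [h.top_eq, h.ground_eq] at he₁
    exact he₁ he₁n
  · rintro ⟨y, z, hy, hz, hsup, hinf, hmod⟩
    obtain ⟨e1, e2⟩ := h.isConfig.inter_eq_and_union_eq_of_modular hmod.1 hmod.2
    have hρ := hmod.2
    rw [hsup, hinf, h.isConfig.rank_eq_zero h.bot_eq] at hρ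
    rw [hsup] at e2
    have hge : ∀ B, M.IsBase B → cnt B (q + 1) = v →
        ρ y + ρ z ≤ (B ∩ φ y).ncard + (B ∩ φ z).ncard := by
      intro B hB hc
      have h1 := ncard_union_le (B ∩ φ y) (B ∩ φ z)
      rw [← inter_union_distrib_left, e2, hval B hB hc] at h1
      omega
    have hy' := hrep (φ y) fun p hp hpq => hsw.mem_iff_succ_mem hfin (hle y z) hge hp hpq
    have hz' := hrep (φ z) fun p hp hpq => hsw.mem_iff_succ_mem hfin (hle z y)
      (fun B hB hc => by have := hge B hB hc; omega) hp hpq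
    rw [← e2] at he₀
    rcases he₀ with he₀ | he₀
    · refine hy (le_antisymm (hsup ▸ le_sup_left) ?_)
      rw [← h.isConfig.subset_iff]
      exact fun p hp => (hy'.1 p hp).2 he₀
    · refine hz (le_antisymm (hsup ▸ le_sup_right) ?_)
      rw [← h.isConfig.subset_iff]
      exact fun p hp => (hz'.1 p hp).2 he₀
  · rintro ⟨y, z, hy, hz, hsup, hinf, hmod⟩
    obtain ⟨e1, e2⟩ := h.isConfig.inter_eq_and_union_eq_of_modular hmod.1 hmod.2
    have hρ := hmod.2
    rw [hsup, hinf] at hρ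
    rw [hsup, h.top_eq] at e2
    rw [hinf] at e1
    have hge : ∀ B, M.IsBase B → cnt B (q + 1) = v →
        ρ y + ρ z ≤ (B ∩ φ y).ncard + (B ∩ φ z).ncard := by
      intro B hB hc
      have hBf := hfin.subset hB.subset_ground
      have h1 := ncard_union_add_ncard_inter (B ∩ φ y) (B ∩ φ z) (hBf.subset inter_subset_left)
        (hBf.subset inter_subset_left)
      rw [← inter_union_distrib_left, e2, ← inter_inter_distrib_left, e1, hval B hB hc,
        inter_eq_left.2 hB.subset_ground, h.rank_top hB] at h1
      omega
    have hy' := hrep (φ y) fun p hp hpq => hsw.mem_iff_succ_mem hfin (hle y z) hge hp hpq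
    have hz' := hrep (φ z) fun p hp hpq => hsw.mem_iff_succ_mem hfin (hle z y)
      (fun B hB hc => by have := hge B hB hc; omega) hp hpq
    -- A part containing `φ x` and one element outside it is everything; the other part then equals
    -- the meet `x`.
    have hfull : ∀ w, x ≤ w → (∀ p < n, p ∉ φ x → (p ∈ φ w ↔ e₁ ∈ φ w)) → e₁ ∈ φ w → t ≤ w := by
      intro w hxw hw hew
      rw [← h.isConfig.subset_iff, h.top_eq, h.ground_eq]
      intro p hp
      by_cases hpx : p ∈ φ x
      · exact (h.isConfig.subset_iff _ _).2 hxw hpx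
      · exact (hw p hp hpx).2 hew
    have he : e₁ ∈ φ y ∪ φ z := by rw [e2, h.ground_eq]; exact he₁n
    rcases he with he | he
    · have := hfull y (hinf ▸ inf_le_left) hy'.2 he
      refine hz (hinf ▸ (inf_eq_right.2 (le_trans ?_ this)).symm)
      exact hsup ▸ le_sup_right
    · have := hfull z (hinf ▸ inf_le_right) hz'.2 he
      refine hy (hinf ▸ (inf_eq_left.2 (le_trans ?_ this)).symm)
      exact hsup ▸ le_sup_left

/-- A path leaving the region already does so at a corner of a bounding path, and the rank bound of
the fundamental flat at that corner rules this out. -/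
theorem isBase_iff (h : IsConnectedLP M P Q n s ρ b t φ) {B : Set ℕ} (hB : B ⊆ Iio n) :
    M.IsBase B ↔ B.ncard = ρ t ∧ ∀ x, IsFundamental s ρ b t x → (B ∩ φ x).ncard ≤ ρ x := by
  constructor
  · exact fun hB => ⟨h.rank_top hB, fun x _ => h.isConfig.ncard_inter_le hB.indep x⟩
  · rintro ⟨hcard, hfund⟩
    have hQn := h.rank_top h.isLP.isBase_right
    have hPn := h.rank_top h.isLP.isBase_left
    have hQE : Q ⊆ Iio n := h.ground_eq ▸ h.isLP.right_subset
    have hPE : P ⊆ Iio n := h.ground_eq ▸ h.isLP.left_subset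
    rw [h.isLP.isBase_iff B (h.ground_eq ▸ hB)]
    intro k
    constructor
    · by_contra! hlt
      obtain ⟨q, hqn, hq, hq', hlt⟩ := exists_corner_of_lt_cnt hB hPE (by omega) hlt
      obtain ⟨hz, hzr⟩ := h.isLP.Ico_mem_cyclicFlats h.ground_eq h.isStrict hqn hq hq'
      obtain ⟨x, hx⟩ := (h.isConfig.mem_iff _).1 hz
      rw [← hx, h.isConfig.eRk_eq, Nat.cast_inj] at hzr
      have hf := h.isFundamental_of_hasSwaps hqn
        (h.isLP.hasSwaps_left h.ground_eq h.isStrict hq hq') (Or.inr hx) fun B hB hc => by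
          have := h.isLP.cnt_add_ncard_Ico_of_isBase h.ground_eq hB hqn.le
          rw [hx]
          omega
      have h1 := hfund x hf
      have h2 := cnt_add_ncard_inter_Ico B hqn.le
      rw [cnt_eq_ncard hB, ← hx] at h2
      have h3 := cnt_mono P hqn.le
      rw [cnt_eq_ncard hPE] at h3
      omega
    · by_contra! hlt
      obtain ⟨q, hq, hq', hlt⟩ := exists_corner_of_cnt_lt hB hQE (by omega) hlt
      obtain ⟨hz, hzr⟩ := h.isLP.Iio_mem_cyclicFlats h.ground_eq h.isStrict hq hq'
      obtain ⟨x, hx⟩ := (h.isConfig.mem_iff _).1 hz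
      rw [← hx, h.isConfig.eRk_eq, Nat.cast_inj] at hzr
      have hf := h.isFundamental_of_hasSwaps (hQE hq')
        (h.isLP.hasSwaps_right h.ground_eq h.isStrict hq hq') (Or.inl hx) fun B hB hc => by
          rw [hx, hzr]
          exact hc
      have h1 := hfund x hf
      rw [hx] at h1
      change cnt B (q + 1) ≤ _ at h1
      omega

/-- Segments of one kind are nested. A proper nonempty initial segment misses `n - 1` and contains
`0`, a final one the reverse, so neither contains the other. -/
theorem le_or_le_iff (h : IsConnectedLP M P Q n s ρ b t φ) (hx : IsFundamental s ρ b t x)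
    (hy : IsFundamental s ρ b t y) :
    (x ≤ y ∨ y ≤ x) ↔ (φ x = Iio (s x) ↔ φ y = Iio (s y)) := by
  obtain ⟨hx0, hxn⟩ := h.ncard_pos_and_lt hx.1 hx.2.1
  obtain ⟨hy0, hyn⟩ := h.ncard_pos_and_lt hy.1 hy.2.1
  have hne : ∀ i j, 0 < i → i < n → 0 < j → j < n → ¬ (Iio i ⊆ Ico (n - j) n) ∧
      ¬ (Ico (n - j) n ⊆ Iio i) := by
    intro i j hi hin hj hjn
    constructor
    · intro hsub
      have := hsub (mem_Iio.2 hi)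
      rw [mem_Ico] at this
      omega
    · intro hsub
      have := hsub (mem_Ico.2 (show n - j ≤ n - 1 ∧ n - 1 < n by omega))
      rw [mem_Iio] at this
      omega
  rw [← h.isConfig.subset_iff, ← h.isConfig.subset_iff]
  have e1 := hne (s x) (s y) hx0 hxn hy0 hyn
  have e2 := hne (s y) (s x) hy0 hyn hx0 hxn
  have e3 := hne (s x) (s x) hx0 hxn hx0 hxn
  have e4 := hne (s y) (s y) hy0 hyn hy0 hyn
  rcases h.eq_Iio_or_eq_Ico hx with hx' | hx' <;> rcases h.eq_Iio_or_eq_Ico hy with hy' | hy' <;>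
    rw [hx', hy']
  · refine iff_of_true ?_ (iff_of_true rfl rfl)
    rcases le_total (s x) (s y) with h' | h'
    · exact Or.inl (Iio_subset_Iio h')
    · exact Or.inr (Iio_subset_Iio h')
  · refine iff_of_false (not_or.2 ⟨e1.1, e1.2⟩) fun h' => ?_
    exact e4.2 (h'.1 rfl).subset
  · refine iff_of_false (not_or.2 ⟨e2.2, e2.1⟩) fun h' => ?_
    exact e3.2 (h'.2 rfl).subset
  · refine iff_of_true ?_ (iff_of_false (fun h' => e3.2 h'.subset) fun h' => e4.2 h'.subset)
    rcases le_total (s x) (s y) with h' | h'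
    · exact Or.inl (Ico_subset_Ico_left (by omega))
    · exact Or.inr (Ico_subset_Ico_left (by omega))

end IsConnectedLP

theorem hasIso_of_map_eq {α β : Type*} {M : Matroid α} {N : Matroid β} {f : α → β}
    (hf : InjOn f M.E) (h : M.map f hf = N) : HasIso M N := by
  subst h
  exact ⟨f, hf.bijOn_image, fun I hI => (Matroid.map_image_indep_iff hI).symm⟩

theorem hasIso_of_isBase {α β : Type*} {M : Matroid α} {N : Matroid β} (f : α → β)
    (hf : BijOn f M.E N.E) (h : ∀ B ⊆ M.E, M.IsBase B ↔ N.IsBase (f '' B)) : HasIso M N := by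
  refine hasIso_of_map_eq hf.injOn (Matroid.ext_isBase hf.image_eq fun B' hB' => ?_)
  obtain ⟨B, hB, rfl⟩ := subset_image_iff.1 hB'
  rw [Matroid.map_image_isBase_iff hB, h B hB]

theorem IsConnectedLP.hasIso {M N : Matroid ℕ} {P Q P' Q' : Set ℕ} {n n' : ℕ} {φ φ' : L → Set ℕ}
    (hM : IsConnectedLP M P Q n s ρ b t φ) (hN : IsConnectedLP N P' Q' n' s ρ b t φ') :
    HasIso M N := by
  obtain rfl : n = n' := hM.size_top.symm.trans hN.size_top
  have htype : (∀ x, IsFundamental s ρ b t x → (φ x = Iio (s x) ↔ φ' x = Iio (s x))) ∨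
      ∀ x, IsFundamental s ρ b t x → (φ x = Iio (s x) ↔ ¬ φ' x = Iio (s x)) := by
    by_cases hex : ∃ x₀, IsFundamental s ρ b t x₀
    · obtain ⟨x₀, hx₀⟩ := hex
      -- Having the same kind as `x₀` is comparability with `x₀`, a property of `L` alone, hence the
      -- same for both matroids.
      have key : ∀ x, IsFundamental s ρ b t x → ((φ x = Iio (s x) ↔ φ x₀ = Iio (s x₀)) ↔
          (φ' x = Iio (s x) ↔ φ' x₀ = Iio (s x₀))) := fun x hx => by
        rw [← hM.le_or_le_iff hx hx₀, ← hN.le_or_le_iff hx hx₀]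
      by_cases h0 : φ x₀ = Iio (s x₀) ↔ φ' x₀ = Iio (s x₀)
      · exact Or.inl fun x hx => by have := key x hx; tauto
      · exact Or.inr fun x hx => by have := key x hx; tauto
    · exact Or.inl fun x hx => absurd ⟨x, hx⟩ hex
  rcases htype with htype | htype
  · refine hasIso_of_isBase id ?_ fun B hB => ?_
    · rw [hM.ground_eq, hN.ground_eq]; exact bijOn_id _
    · rw [hM.ground_eq] at hB
      rw [image_id, hM.isBase_iff hB, hN.isBase_iff hB]
      refine and_congr_right fun _ => forall₂_congr fun x hx => ?_
      have : φ x = φ' x := by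
        by_cases h0 : φ x = Iio (s x)
        · rw [h0, (htype x hx).1 h0]
        · rw [(hM.eq_Iio_or_eq_Ico hx).resolve_left h0,
            (hN.eq_Iio_or_eq_Ico hx).resolve_left (mt (htype x hx).2 h0)]
      rw [this]
  · have hmaps : MapsTo (fun j => n - 1 - j) (Iio n) (Iio n) := fun j hj => by
      simp only [mem_Iio] at hj ⊢; omega
    have hinv : ∀ j ∈ Iio n, n - 1 - (n - 1 - j) = j := fun j hj => by
      rw [mem_Iio] at hj; omega
    have hbij : BijOn (fun j => n - 1 - j) (Iio n) (Iio n) :=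
      InvOn.bijOn ⟨hinv, hinv⟩ hmaps hmaps
    refine hasIso_of_isBase (fun j => n - 1 - j) ?_ fun B hB => ?_
    · rw [hM.ground_eq, hN.ground_eq]; exact hbij
    · rw [hM.ground_eq] at hB
      have hB' : (fun j => n - 1 - j) '' B ⊆ Iio n := (hmaps.mono_left hB).image_subset
      rw [hM.isBase_iff hB, hN.isBase_iff hB', (hbij.injOn.mono hB).ncard_image]
      refine and_congr_right fun _ => forall₂_congr fun x hx => ?_
      have hsn := (hM.ncard_pos_and_lt hx.1 hx.2.1).2
      have : (fun j => n - 1 - j) '' B ∩ φ' x = (fun j => n - 1 - j) '' (B ∩ φ x) := by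
        have hmem : ∀ j < n, (n - 1 - j ∈ φ' x ↔ j ∈ φ x) := by
          intro j hj
          by_cases h0 : φ x = Iio (s x)
          · rw [h0, (hN.eq_Iio_or_eq_Ico hx).resolve_left ((htype x hx).1 h0), mem_Ico, mem_Iio]
            omega
          · rw [(hM.eq_Iio_or_eq_Ico hx).resolve_left h0, not_not.1 (mt (htype x hx).2 h0),
              mem_Ico, mem_Iio]
            omega
        ext e
        constructor
        · rintro ⟨⟨j, hj, rfl⟩, he⟩
          exact ⟨j, ⟨hj, (hmem j (hB hj)).1 he⟩, rfl⟩
        · rintro ⟨j, ⟨hj, hjx⟩, rfl⟩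
          exact ⟨⟨j, hj, rfl⟩, (hmem j (hB hj)).2 hjx⟩
      rw [this, (hbij.injOn.mono (inter_subset_left.trans hB)).ncard_image]

end Fundamental

/-! ### Assembling isomorphisms -/

section Assembly

variable {α β γ : Type*}

theorem HasIso.trans {M : Matroid α} {N : Matroid β} {K : Matroid γ} (h : HasIso M N)
    (h' : HasIso N K) : HasIso M K := by
  obtain ⟨f, hf, hfI⟩ := h
  obtain ⟨g, hg, hgI⟩ := h'
  refine ⟨g ∘ f, hg.comp hf, fun I hI => ?_⟩
  rw [hfI I hI, hgI _ ((image_mono hI).trans hf.image_eq.subset), image_comp]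

theorem HasIso.symm [Nonempty α] {M : Matroid α} {N : Matroid β} (h : HasIso M N) :
    HasIso N M := by
  obtain ⟨f, hf, hfI⟩ := h
  have hinv := hf.invOn_invFunOn
  refine ⟨Function.invFunOn f M.E, hf.symm hinv.symm, fun I hI => ?_⟩
  have hsub : Function.invFunOn f M.E '' I ⊆ M.E :=
    (image_mono hI).trans (hf.symm hinv.symm).image_eq.subset
  rw [hfI _ hsub, (hinv.2.mono hI).image_image]

theorem HasIso.isomorphic {M : Matroid α} {N : Matroid β} (h : HasIso M N) : Isomorphic M N := by
  obtain ⟨f, hf, hfI⟩ := h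
  refine ⟨hf.equiv f, fun I => ?_⟩
  rw [hfI _ (by rintro _ ⟨x, -, rfl⟩; exact x.2), image_image, image_image]
  rfl

theorem Isomorphic.symm {M : Matroid α} {N : Matroid β} (h : Isomorphic M N) : Isomorphic N M := by
  obtain ⟨e, he⟩ := h
  refine ⟨e.symm, fun I => ?_⟩
  rw [he, e.image_symm_image]

theorem Isomorphic.trans {M : Matroid α} {N : Matroid β} {K : Matroid γ} (h : Isomorphic M N)
    (h' : Isomorphic N K) : Isomorphic M K := by
  obtain ⟨e, he⟩ := h
  obtain ⟨e', he'⟩ := h'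
  refine ⟨e.trans e', fun I => ?_⟩
  rw [he, he', image_image, image_image, image_image]
  rfl

theorem exists_bijOn_of_ncard_eq {X Y : Set ℕ} (hX : X.Finite) (hY : Y.Finite)
    (h : X.ncard = Y.ncard) : ∃ f : ℕ → ℕ, BijOn f X Y := by
  have : X.encard = Y.encard := by rw [← hX.cast_ncard_eq, ← hY.cast_ncard_eq, h]
  exact hX.exists_bijOn_of_encard_eq this

theorem hasIso_of_forall_indep {M N : Matroid ℕ} (hM : M.E.Finite) (hN : N.E.Finite)
    (h : M.E.ncard = N.E.ncard) (hMI : ∀ I ⊆ M.E, M.Indep I) (hNI : ∀ I ⊆ N.E, N.Indep I) :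
    HasIso M N := by
  obtain ⟨f, hf⟩ := exists_bijOn_of_ncard_eq hM hN h
  exact ⟨f, hf, fun I hI => iff_of_true (hMI I hI)
    (hNI _ ((image_mono hI).trans hf.image_eq.subset))⟩

theorem hasIso_of_forall_indep_iff_eq_empty {M N : Matroid ℕ} (hM : M.E.Finite) (hN : N.E.Finite)
    (h : M.E.ncard = N.E.ncard) (hMI : ∀ I ⊆ M.E, M.Indep I → I = ∅)
    (hNI : ∀ I ⊆ N.E, N.Indep I → I = ∅) : HasIso M N := by
  obtain ⟨f, hf⟩ := exists_bijOn_of_ncard_eq hM hN h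
  refine ⟨f, hf, fun I hI => ⟨fun h' => ?_, fun h' => ?_⟩⟩
  · rw [hMI I hI h', image_empty]; exact N.empty_indep
  · rw [image_eq_empty.1 (hNI _ ((image_mono hI).trans hf.image_eq.subset) h')]
    exact M.empty_indep

end Assembly

/-! ### Reconstruction from the configuration -/

section Reconstruction

variable {L : Type*} [Lattice L] {s ρ : L → ℕ} {b t : L}

theorem IsConfig.isSep_of_decomposes {α : Type*} {M : Matroid α} {φ : L → Set α}
    (h : IsConfig M s ρ φ) (hb : φ b = ∅) (ht : φ t = M.E) {y z : L} (hsup : y ⊔ z = t)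
    (hinf : y ⊓ z = b) (hmod : IsModularPair s ρ y z) :
    IsSep M (φ y) ∧ M.E \ φ y = φ z := by
  obtain ⟨e1, e2⟩ := h.inter_eq_and_union_eq_of_modular hmod.1 hmod.2
  have hρ := hmod.2
  rw [hsup, hinf, h.rank_eq_zero hb] at hρ
  rw [hsup, ht] at e2
  rw [hinf, hb] at e1
  refine ⟨isSep_of_eRk_add_eRk_le (ht ▸ h.finite t) e2 ?_, ?_⟩
  · rw [h.eRk_eq, h.eRk_eq, ← M.eRk_ground, ← ht, h.eRk_eq]
    exact_mod_cast hρ.le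
  · rw [← e2, union_sdiff_left, sdiff_eq_left]
    exact (disjoint_iff_inter_eq_empty.2 e1).symm

/-- The lattice is quantified inside the induction because each summand has its own lattice of
cyclic flats, the elements of `L` below it. -/
theorem hasIso_of_isConfig_of_bot_of_top.{w} (n : ℕ) : ∀ (L : Type w) (_ : Lattice L) (s ρ : L → ℕ) (b t : L)
    (M N : Matroid ℕ) (P Q P' Q' : Set ℕ) (φ φ' : L → Set ℕ), IsLP M P Q → IsLP N P' Q' →
    IsConfig M s ρ φ → IsConfig N s ρ φ' → φ b = ∅ → φ t = M.E → φ' b = ∅ → φ' t = N.E → s t = n →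
    HasIso M N := by
  induction n using Nat.strong_induction_on with
  | _ n ih =>
    intro L _ s ρ b t M N P Q P' Q' φ φ' hM hN hφ hφ' hb ht hb' ht' hn
    by_cases hdec : Decomposes s ρ b t
    · obtain ⟨y, z, hy, hz, hsup, hinf, hmod⟩ := hdec
      have hlt : ∀ w, w ≤ t → w ≠ t → s w < n := by
        intro w hw hwt
        rw [← hn, ← hφ.ncard_eq, ← hφ.ncard_eq]
        exact ncard_lt_ncard (ssubset_iff_subset_ne.2 ⟨(hφ.subset_iff _ _).2 hw,
          fun h => hwt (hφ.injective h)⟩) (hφ.finite t)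
      have hbw : ∀ w, b ≤ w := fun w => by
        rw [← hφ.subset_iff, hb]; exact empty_subset _
      have hrec : ∀ w, w ≤ t → w ≠ t → IsSep M (φ w) → IsSep N (φ' w) →
          HasIso (M ↾ φ w) (N ↾ φ' w) := fun w hw hwt hs hs' =>
        ih (s w) (hlt w hw hwt) (Iic w) inferInstance (fun x => s x) (fun x => ρ x)
          ⟨b, hbw w⟩ ⟨w, le_rfl⟩ _ _ _ _ _ _ _ _ (hM.restrict hs) (hN.restrict hs')
          (hφ.restrict w) (hφ'.restrict w) hb rfl hb' rfl rfl
      obtain ⟨s1, c1⟩ := hφ.isSep_of_decomposes hb ht hsup hinf hmod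
      obtain ⟨s2, c2⟩ := hφ'.isSep_of_decomposes hb' ht' hsup hinf hmod
      refine HasIso.glue s1 s2 (hrec y (hsup ▸ le_sup_left) hy s1 s2) ?_
      rw [c1, c2]
      exact hrec z (hsup ▸ le_sup_right) hz (c1 ▸ s1.compl) (c2 ▸ s2.compl)
    · obtain ⟨f, hf, A, B, hLP, hE⟩ := hM.exists_map
      obtain ⟨g, hg, A', B', hLP', hE'⟩ := hN.exists_map
      have h1 : IsConnectedLP (M.map f hf) A B _ s ρ b t (fun x => f '' φ x) :=
        ⟨hLP, hE, hφ.map hf, by rw [hb, image_empty], by rw [ht]; rfl, hdec⟩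
      have h2 : IsConnectedLP (N.map g hg) A' B' _ s ρ b t (fun x => g '' φ' x) :=
        ⟨hLP', hE', hφ'.map hg, by rw [hb', image_empty], by rw [ht']; rfl, hdec⟩
      exact ((hasIso_of_map_eq hf rfl).trans (h1.hasIso h2)).trans (hasIso_of_map_eq hg rfl).symm

theorem IsConfig.exists_eq_loops {α : Type*} {M : Matroid α} {φ : L → Set α}
    (h : IsConfig M s ρ φ) : ∃ b, φ b = M.loops ∧ ∀ x, b ≤ x := by
  obtain ⟨b, hb⟩ := (h.mem_iff _).1 (loops_mem_cyclicFlats M)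
  refine ⟨b, hb, fun x => ?_⟩
  rw [← h.subset_iff, hb, ← (h.isFlat x).closure]
  exact M.closure_subset_closure (empty_subset _)

/-- The closure of the union of all circuits is the largest cyclic flat. Everything outside it is a
coloop, invisible to the lattice and recovered from the size of the ground set. -/
theorem IsConfig.exists_forall_isCircuit_subset {α : Type*} {M : Matroid α} {φ : L → Set α}
    (h : IsConfig M s ρ φ) : ∃ t, (∀ C, M.IsCircuit C → C ⊆ φ t) ∧ ∀ x, x ≤ t := by
  have hcyc : IsCyclicSet M (⋃₀ {C | M.IsCircuit C}) := ⟨_, fun C hC => hC, rfl⟩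
  obtain ⟨t, ht⟩ := (h.mem_iff _).1 hcyc.closure_mem_cyclicFlats
  have hsub := M.subset_closure _ hcyc.subset_ground
  rw [← ht] at hsub
  have hC : ∀ C, M.IsCircuit C → C ⊆ φ t := fun C hC => (subset_sUnion_of_mem hC).trans hsub
  refine ⟨t, hC, fun x => ?_⟩
  rw [← h.subset_iff]
  intro e he
  obtain ⟨C, h1, h2, -⟩ := isCyclicSet_iff_exists_isCircuit.1 (h.mem x).2 e he
  exact hC C h1 h2

theorem isSep_of_forall_isCircuit_subset {α : Type*} {M : Matroid α} {T : Set α} (hT : T ⊆ M.E)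
    (h : ∀ C, M.IsCircuit C → C ⊆ T) : IsSep M T := by
  refine ⟨hT, fun I hI h1 _ => ?_⟩
  by_contra hni
  obtain ⟨C, hCI, hC⟩ := Matroid.Dep.exists_isCircuit_subset ⟨hni, hI⟩
  exact hC.not_indep (h1.subset (subset_inter hCI (h C hC)))

theorem indep_of_disjoint_of_forall_isCircuit_subset {α : Type*} {M : Matroid α} {T I : Set α}
    (h : ∀ C, M.IsCircuit C → C ⊆ T) (hI : I ⊆ M.E \ T) : M.Indep I := by
  by_contra hni
  obtain ⟨C, hCI, hC⟩ := Matroid.Dep.exists_isCircuit_subset ⟨hni, hI.trans sdiff_subset⟩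
  obtain ⟨e, he⟩ := hC.nonempty
  exact (hI (hCI he)).2 (h C hC he)

theorem eq_empty_of_indep_of_subset_loops {α : Type*} {M : Matroid α} {I : Set α} (hI : M.Indep I)
    (hIl : I ⊆ M.loops) : I = ∅ := by
  rw [eq_empty_iff_forall_notMem]
  intro e he
  have hl : M.IsLoop e := hIl he
  exact hl.not_indep_of_mem he hI

theorem isSep_sdiff_loops {α : Type*} (M : Matroid α) : IsSep M (M.E \ M.loops) := by
  refine ⟨sdiff_subset, fun I hI h1 h2 => ?_⟩
  have : I \ (M.E \ M.loops) = ∅ := by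
    refine eq_empty_of_indep_of_subset_loops h2 fun e he => ?_
    by_contra h
    exact he.2 ⟨hI he.1, h⟩
  rw [← inter_union_sdiff I (M.E \ M.loops), this, union_empty]
  exact h1

theorem hasIso_of_isConfig_of_top {M N : Matroid ℕ} {P Q P' Q' : Set ℕ} {φ φ' : L → Set ℕ}
    (hM : IsLP M P Q) (hN : IsLP N P' Q') (hφ : IsConfig M s ρ φ) (hφ' : IsConfig N s ρ φ')
    (ht : φ t = M.E) (ht' : φ' t = N.E) : HasIso M N := by
  obtain ⟨b, hb, hbx⟩ := hφ.exists_eq_loops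
  obtain ⟨b', hb', hbx'⟩ := hφ'.exists_eq_loops
  obtain rfl : b = b' := le_antisymm (hbx _) (hbx' _)
  have hlE : M.loops ⊆ M.E := hb ▸ hφ.subset_ground b
  have hlE' : N.loops ⊆ N.E := hb' ▸ hφ'.subset_ground b
  refine HasIso.glue (isSep_sdiff_loops M) (isSep_sdiff_loops N) ?_ ?_
  · exact hasIso_of_isConfig_of_bot_of_top _ L inferInstance (fun x => s x - s b) ρ b t _ _ _ _ _ _ _ _
      (hM.restrict (isSep_sdiff_loops M)) (hN.restrict (isSep_sdiff_loops N))
      (hφ.restrict_sdiff_loops hb) (hφ'.restrict_sdiff_loops hb')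
      (by rw [hb, sdiff_self]) (by rw [ht]; rfl) (by rw [hb', sdiff_self]) (by rw [ht']; rfl) rfl
  · rw [sdiff_sdiff_cancel_left hlE, sdiff_sdiff_cancel_left hlE']
    refine hasIso_of_forall_indep_iff_eq_empty (hM.finite.subset hlE) (hN.finite.subset hlE') ?_
      (fun I hI h => ?_) (fun I hI h => ?_)
    · rw [Matroid.restrict_ground_eq, Matroid.restrict_ground_eq, ← hb, ← hb', hφ.ncard_eq,
        hφ'.ncard_eq]
    · exact eq_empty_of_indep_of_subset_loops (Matroid.restrict_indep_iff.1 h).1 hI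
    · exact eq_empty_of_indep_of_subset_loops (Matroid.restrict_indep_iff.1 h).1 hI

theorem hasIso_of_isConfig {M N : Matroid ℕ} {P Q P' Q' : Set ℕ} {φ φ' : L → Set ℕ}
    (hM : IsLP M P Q) (hN : IsLP N P' Q') (hφ : IsConfig M s ρ φ) (hφ' : IsConfig N s ρ φ')
    (hE : M.E.ncard = N.E.ncard) : HasIso M N := by
  obtain ⟨t, ht, htx⟩ := hφ.exists_forall_isCircuit_subset
  obtain ⟨t', ht', htx'⟩ := hφ'.exists_forall_isCircuit_subset
  obtain rfl : t = t' := le_antisymm (htx' _) (htx _)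
  have hs := isSep_of_forall_isCircuit_subset (hφ.subset_ground t) ht
  have hs' := isSep_of_forall_isCircuit_subset (hφ'.subset_ground t) ht'
  refine HasIso.glue hs hs' ?_ ?_
  · exact hasIso_of_isConfig_of_top (t := (⟨t, le_rfl⟩ : Iic t)) (hM.restrict hs) (hN.restrict hs')
      (hφ.restrict t) (hφ'.restrict t) rfl rfl
  · refine hasIso_of_forall_indep (hM.finite.subset sdiff_subset) (hN.finite.subset sdiff_subset) ?_
      (fun I hI => ?_) (fun I hI => ?_)
    · rw [Matroid.restrict_ground_eq, Matroid.restrict_ground_eq,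
        ncard_sdiff (hφ.subset_ground t) (hφ.finite t), ncard_sdiff (hφ'.subset_ground t) (hφ'.finite t),
        hφ.ncard_eq, hφ'.ncard_eq, hE]
    · exact Matroid.restrict_indep_iff.2 ⟨indep_of_disjoint_of_forall_isCircuit_subset ht hI, hI⟩
    · exact Matroid.restrict_indep_iff.2 ⟨indep_of_disjoint_of_forall_isCircuit_subset ht' hI, hI⟩

theorem IsLatticePathMatroid.exists_isLP_map {α : Type*} {M : Matroid α}
    (h : IsLatticePathMatroid M) :
    ∃ (f : α → ℕ) (hf : InjOn f M.E) (P Q : Set ℕ), IsLP (M.map f hf) P Q := by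
  classical
  obtain ⟨m, r, P, Q, hPQ, e, he⟩ := h
  -- The value `0` off the ground set is harmless: only injectivity on `M.E` is needed.
  let f : α → ℕ := fun x => if hx : x ∈ M.E then ((e ⟨x, hx⟩ : Fin (m + r)) : ℕ) else 0
  have hfe : ∀ x : M.E, f x = ((e x : Fin (m + r)) : ℕ) := fun x => dif_pos x.2
  have hf : InjOn f M.E := by
    intro x hx y hy hxy
    rw [hfe ⟨x, hx⟩, hfe ⟨y, hy⟩] at hxy
    exact congrArg Subtype.val (e.injective (Subtype.ext (Fin.val_injective hxy)))
  have himg : ∀ I : Set M.E, f '' (Subtype.val '' I) = Fin.val '' (Subtype.val '' (e '' I)) := by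
    intro I
    rw [image_image, image_image, image_image]
    exact image_congr fun x _ => hfe x
  have hmap : M.map f hf = (pathMatroid P Q).map Fin.val Fin.val_injective.injOn := by
    refine Matroid.ext_indep ?_ fun I hI => ?_
    · have := himg univ
      rw [image_univ, Subtype.range_coe, image_univ, e.range_eq_univ, image_univ,
        Subtype.range_coe] at this
      exact this
    · obtain ⟨J, hJ, rfl⟩ := subset_image_iff.1 hI
      obtain ⟨J, rfl⟩ : ∃ J' : Set M.E, Subtype.val '' J' = J :=
        ⟨Subtype.val ⁻¹' J, by rw [Subtype.image_preimage_coe, inter_eq_right.2 hJ]⟩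
      rw [Matroid.map_image_indep_iff hJ, himg, Matroid.map_image_indep_iff (subset_univ _), he]
  exact ⟨f, hf, _, _, hmap ▸ isLP_map_pathMatroid hPQ⟩

end Reconstruction

end LatticePathMatroid

theorem mainTheorem12 {α : Type*} {β : Type*} (M : Matroid α) (N : Matroid β)
    (hM : LatticePathMatroid.IsLatticePathMatroid M)
    (hN : LatticePathMatroid.IsLatticePathMatroid N)
    (hMN : LatticePathMatroid.SameConfiguration M N) :
    LatticePathMatroid.Isomorphic M N := by
  open LatticePathMatroid in
  obtain ⟨L, _, s, ρ, n, hLM, hLN⟩ := hMN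
  obtain ⟨f, hf, P, Q, hfLP⟩ := hM.exists_isLP_map
  obtain ⟨g, hg, P', Q', hgLP⟩ := hN.exists_isLP_map
  obtain ⟨φ, hφ⟩ := hLM.exists_isConfig
  obtain ⟨φ', hφ'⟩ := hLN.exists_isConfig
  have hE : (M.map f hf).E.ncard = (N.map g hg).E.ncard := by
    rw [Matroid.map_ground, Matroid.map_ground, hf.ncard_image, hg.ncard_image, Set.ncard, Set.ncard,
      hLM.1, hLN.1]
  exact ((hasIso_of_map_eq hf rfl).isomorphic.trans
    (hasIso_of_isConfig hfLP hgLP (hφ.map hf) (hφ'.map hg) hE).isomorphic).trans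
    (hasIso_of_map_eq hg rfl).isomorphic.symm
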